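/- Let $Y$ be the triod: three copies of $[0,1]$ (the closed branches) glued at a common end point $a$; the components of $Y\setminus\{a\}$ are the branches. Let $\mathcal U$ be the set of continuous maps $Y\to Y$ whose unique fixed point is $a$. Below, a cycle is a periodic orbit not containing $a$, and $[A]$ is the convex hull of $A\subset Y$ (the union of all arcs with end points in $A$). Two cycles, $P$ of $f$ and $Q$ of $g$, exhibit the same pattern if some homeomorphism $[P]\to[Q]$ fixes each branch, maps $P$ onto $Q$ and conjugates $f|_P$ to $g|_Q$. A pattern $A$ forces a pattern $B$ if every map in $\mathcal U$ with a cycle of pattern $A$ has a cycle of pattern $B$ (the forced patterns considered are those of cycles of maps in $\mathcal U$). A pattern is primitive if all points of its cycles lie on distinct branches, and regular if it forces no primitive pattern of period $2$. Let $b_0,b_1,b_2$ be an ordering of the branches (indices modulo $3$). For $u\in b_i$, $v\in b_{i+k}$ with $k\in\{0,1,2\}$ put $d(u\to v)=k/3$. A point $x$ of a cycle of $f$ is green, black or red if $d(x\to f(x))$ is $0$, $\frac13$ or $\frac23$, respectively, and the rotation number of the cycle is the average of $d(x\to f(x))$ over its points. The ordering is canonical for a cycle if on each branch there are points of the cycle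 and the one closest to $a$ is black. A triod–twist cycle is a cycle whose pattern is regular and forces no other pattern with the same rotation number. A state of a cycle $P$ is an equivalence class of the relation: $x,y\in P$ lie on the same branch, have the same color, and no point of $P$ of a different color lies between them; it is green (red) if its points are. A map $f$ is $P$-linear if it is continuous, fixes $a$, is affine on each component of $[P]\setminus(P\cup\{a\})$ (that is, multiplies arc lengths there by a constant) and is constant on each component of $Y\setminus[P]$. A map is monotone on $U\subset Y$ if the preimage in $U$ of each point of $f(U)$ is connected; a lap of $f$ is a maximal connected open set on which $f$ is monotone, and the modality of $f$ is the number of its laps. **Lemma.** Let $P$ be a triod–twist cycle of its $P$-linear map $f$, the branches being labelled by an ordering that is canonical for $P$ (if $P$ has a canonical ordering; otherwise by any ordering). Then $f$ has finitely many laps, and if $m$ is its modality, then the number of green states of $P$ and the number of red states of $P$ are each strictly less than $\frac m2+2$. -/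

import Mathlib

/-- The triod `Y`: three copies of `[0,1]`, indexed by `ZMod 3`, glued at `0`. A point is given by
its three coordinates, at most one of which is nonzero; the topology is that of `ℝ³`. -/
abbrev Triod : Type :=
  {v : ZMod 3 → ℝ // (∀ i, 0 ≤ v i ∧ v i ≤ 1) ∧ ∀ i j, i ≠ j → v i = 0 ∨ v j = 0}

namespace Triod

/-- The branching point `a`. -/
def center : Triod := ⟨fun _ => 0, fun _ => ⟨le_rfl, zero_le_one⟩, fun _ _ _ => Or.inl rfl⟩

/-- `x` lies on the branch number `i`, a component of `Y \ {a}`. -/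
def OnBranch (i : ZMod 3) (x : Triod) : Prop := 0 < x.1 i

/-- The length of the arc from `x` to `y`: it is `|s - t|` for points at distance `s`, `t` from `a`
on the same branch, and `s + t` for points on different branches. -/
def arcDist (x y : Triod) : ℝ := ∑ i, |x.1 i - y.1 i|

/-- `z` lies on the arc `[x, y]` of the triod. -/
def Between (x z y : Triod) : Prop := arcDist x z + arcDist z y = arcDist x y

/-- The convex hull `[A]`: the union of all arcs with end points in `A`. -/
def hull (A : Set Triod) : Set Triod := {z | ∃ x ∈ A, ∃ y ∈ A, Between x z y}

/-- The class `𝒰`: continuous self-maps of the triod whose unique fixed point is `a`. -/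
structure InU (f : Triod → Triod) : Prop where
  continuous : Continuous f
  fixed_iff : ∀ x, f x = x ↔ x = center

/-- `P` is a cycle (periodic orbit) of `f`, other than the fixed point `a`. -/
def IsCycle (f : Triod → Triod) (P : Set Triod) : Prop :=
  center ∉ P ∧ ∃ x ∈ Function.periodicPts f, P = Set.range fun k : ℕ => f^[k] x

/-- The cycle `P` of `f` and the cycle `Q` of `g` are equivalent (they exhibit the same pattern):
some homeomorphism `[P] → [Q]` fixes each branch, carries `P` onto `Q` and conjugates
`f` on `P` to `g` on `Q`. A pattern is an equivalence class; it is handled through the cycles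
that exhibit it. -/
def SamePattern (f : Triod → Triod) (P : Set Triod) (g : Triod → Triod) (Q : Set Triod) : Prop :=
  ∃ h : hull P ≃ₜ hull Q,
    (∀ (i : ZMod 3) (x : hull P), OnBranch i (h x).1 ↔ OnBranch i x.1) ∧
    (∀ x : hull P, (h x).1 ∈ Q ↔ x.1 ∈ P) ∧
    ∀ x y : hull P, x.1 ∈ P → y.1 = f x.1 → (h y).1 = g (h x).1

/-- The pattern of the cycle `P` of `f` forces the pattern of the cycle `P'` of `f'`: every map
in `𝒰` that has a cycle of the first pattern has a cycle of the second one. -/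
def Forces (f : Triod → Triod) (P : Set Triod) (f' : Triod → Triod) (P' : Set Triod) : Prop :=
  ∀ g : Triod → Triod, InU g →
    (∃ Q, IsCycle g Q ∧ SamePattern f P g Q) → ∃ R, IsCycle g R ∧ SamePattern f' P' g R

/-- All points of `P` lie on distinct branches. -/
def IsPrimitive (P : Set Triod) : Prop :=
  ∀ x ∈ P, ∀ y ∈ P, ∀ i, OnBranch i x → OnBranch i y → x = y

/-- The pattern of the cycle `P` of `f` is regular: it forces no primitive pattern of period 2. -/
def IsRegular (f : Triod → Triod) (P : Set Triod) : Prop :=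
  ∀ (f' : Triod → Triod) (P' : Set Triod), InU f' → IsCycle f' P' →
    IsPrimitive P' → P'.ncard = 2 → ¬ Forces f P f' P'

/-! An ordering `b₀, b₁, b₂` of the branches is a permutation `b` of `ZMod 3`: the branch `bᵢ` is
the one with number `b i`. -/

/-- `u ∈ bᵢ` and `v ∈ bⱼ` with `j = i + k` modulo 3. -/
def HasStep (b : Equiv.Perm (ZMod 3)) (k : ZMod 3) (u v : Triod) : Prop :=
  ∃ i, OnBranch (b i) u ∧ OnBranch (b (i + k)) v

open Classical in
/-- The displacement `d(u → v) ∈ {0, 1/3, 2/3}`. -/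
noncomputable def displacement (b : Equiv.Perm (ZMod 3)) (u v : Triod) : ℝ :=
  if HasStep b 1 u v then 1 / 3 else if HasStep b 2 u v then 2 / 3 else 0

/-- The rotation number of the cycle `P` of `f`: the average of `d(x → f x)` along the cycle. -/
noncomputable def rotationNumber (b : Equiv.Perm (ZMod 3)) (f : Triod → Triod) (P : Set Triod) :
    ℝ :=
  (∑ᶠ x ∈ P, displacement b x (f x)) / (P.ncard : ℝ)

/-- The cycle `P` of `f` is a triod-twist cycle: its pattern is regular and forces no other
pattern with the same rotation number. -/
def IsTriodTwist (b : Equiv.Perm (ZMod 3)) (f : Triod → Triod) (P : Set Triod) : Prop :=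
  IsCycle f P ∧ IsRegular f P ∧
    ∀ (f' : Triod → Triod) (P' : Set Triod), InU f' → IsCycle f' P' →
      rotationNumber b f' P' = rotationNumber b f P → Forces f P f' P' → SamePattern f P f' P'

/-- Colors are residues: green is `0` (displacement `0`). -/
def green : ZMod 3 := 0

/-- Black is `1` (displacement `1/3`). -/
def black : ZMod 3 := 1

/-- Red is `2` (displacement `2/3`). -/
def red : ZMod 3 := 2

/-- The color of the point `x` of a cycle of `f` is the color of the arrow `x → f x`. -/
def HasColor (b : Equiv.Perm (ZMod 3)) (f : Triod → Triod) (c : ZMod 3) (x : Triod) : Prop :=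
  HasStep b c x (f x)

/-- The ordering `b` is canonical for the cycle `P` of `f`: on each branch, the point of `P`
closest to `a` exists and is black. -/
def IsCanonical (b : Equiv.Perm (ZMod 3)) (f : Triod → Triod) (P : Set Triod) : Prop :=
  ∀ i, ∃ p ∈ P, OnBranch (b i) p ∧ (∀ q ∈ P, OnBranch (b i) q → p.1 (b i) ≤ q.1 (b i)) ∧
    HasColor b f black p

/-- `f` is `P`-linear: it fixes `a`, is affine (arc lengths are multiplied by a constant) on every
component of `[P] \ (P ∪ {a})` and constant on every component of `Y \ [P]`. -/
structure IsLinearFor (f : Triod → Triod) (P : Set Triod) : Prop where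
  continuous : Continuous f
  map_center : f center = center
  affine : ∀ x ∈ hull P \ (P ∪ {center}), ∃ c : ℝ,
    ∀ s ∈ connectedComponentIn (hull P \ (P ∪ {center})) x,
      ∀ t ∈ connectedComponentIn (hull P \ (P ∪ {center})) x,
        arcDist (f s) (f t) = c * arcDist s t
  const : ∀ x ∈ (hull P)ᶜ, ∀ s ∈ connectedComponentIn (hull P)ᶜ x, f s = f x

/-- `f` is monotone on `U`: the preimage in `U` of every point of `f(U)` is connected. -/
def IsMonotoneOn (f : Triod → Triod) (U : Set Triod) : Prop :=
  ∀ v ∈ f '' U, IsConnected (U ∩ f ⁻¹' {v})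

/-- The laps of `f`: maximal connected open sets on which `f` is monotone. -/
def laps (f : Triod → Triod) : Set (Set Triod) :=
  {U | Maximal (fun V : Set Triod => IsOpen V ∧ IsConnected V ∧ IsMonotoneOn f V) U}

/-- The modality of `f`: the number of its laps (meaningful when there are finitely many). -/
noncomputable def modality (f : Triod → Triod) : ℕ := (laps f).ncard

/-- The state of a point `x` of color `c`: the points `y ∈ P` of color `c` on the branch of `x`
such that no point of `P` between `x` and `y` has a different color. -/
def stateOf (b : Equiv.Perm (ZMod 3)) (f : Triod → Triod) (P : Set Triod) (c : ZMod 3)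
    (x : Triod) : Set Triod :=
  {y | y ∈ P ∧ HasColor b f c y ∧ (∃ i, OnBranch i x ∧ OnBranch i y) ∧
    ∀ z ∈ P, Between x z y → HasColor b f c z}

/-- The collection of all states of color `c` of the cycle `P` of `f`. -/
def states (b : Equiv.Perm (ZMod 3)) (f : Triod → Triod) (P : Set Triod) (c : ZMod 3) :
    Set (Set Triod) :=
  {S | ∃ x ∈ P, HasColor b f c x ∧ S = stateOf b f P c x}

end Triod

/-!
The bound needs of `P` only that its pattern is regular. If the points of `P` closest to `a` on
two branches were mapped to each other's branch, then every map in `𝒰` with a cycle of this pattern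
would interchange two points of these branches (`InU.exists_two_cycle`), and the pattern would force
a primitive pattern of period 2. A closest point is not green either, as maps in `𝒰` send green
points closer to `a` (`InU.coord_lt`). Hence the branches of the images of the closest points define
a cyclic permutation of the three branches, which yields a canonical ordering
(`IsRegular.exists_isCanonical`). So the given ordering is canonical.

In a canonical ordering the first state on each branch is black. Therefore every green state begins
with a change of color between consecutive points of `P`, and ends with one unless it is the last
state on its branch; the two kinds of color changes are disjoint. If `s` is the number of green
states and `n` is the number of color changes, this gives `2 s ≤ n + 3`
(`two_mul_ncard_states_le`), and likewise for red.

A color change means that the images of two consecutive points are on different branches, so there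
is a preimage of `a` between them; the map is injective there, so this preimage lies in a lap. Two
preimages of `a` in one lap would have only preimages of `a` between them, whereas those that come
from different color changes are separated by a point of `P`. Hence `n ≤ m`
(`IsLinearFor.ncard_colorChanges_le`), and `s ≤ (m + 3) / 2 < m / 2 + 2`.

That there are finitely many laps follows from `IsLinearFor.seg_subset_lap`: a lap that meets a
component of the complement of the finite set of points of `P` and preimages of `a` contains it.
-/

namespace Triod

open Set Function Topology

/-! ### Coordinates on the triod -/

theorem ext_coord {x y : Triod} (h : ∀ k, x.1 k = y.1 k) : x = y := Subtype.ext (funext h)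

theorem OnBranch.eq_zero {i k : ZMod 3} {x : Triod} (h : OnBranch i x) (hk : k ≠ i) :
    x.1 k = 0 :=
  (x.2.2 k i hk).resolve_right (ne_of_gt h)

theorem OnBranch.unique {i j : ZMod 3} {x : Triod} (hi : OnBranch i x) (hj : OnBranch j x) :
    i = j := by
  by_contra h
  exact absurd (hj.eq_zero h) (ne_of_gt hi)

theorem OnBranch.ext {i : ZMod 3} {x y : Triod} (h : OnBranch i x) (hxy : x.1 i = y.1 i) :
    x = y := by
  have hy : OnBranch i y := by unfold OnBranch at *; rwa [← hxy]
  refine ext_coord fun k => ?_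
  by_cases hk : k = i
  · rw [hk, hxy]
  · rw [h.eq_zero hk, hy.eq_zero hk]

theorem not_onBranch_iff {i : ZMod 3} {x : Triod} : ¬ OnBranch i x ↔ x.1 i = 0 :=
  ⟨fun h => le_antisymm (not_lt.1 h) (x.2.1 i).1, fun h => by simp [OnBranch, h]⟩

theorem exists_onBranch {x : Triod} (h : x ≠ center) : ∃ i, OnBranch i x := by
  by_contra hc
  push Not at hc
  exact h (ext_coord fun k => not_onBranch_iff.1 (hc k))

theorem OnBranch.ne_center {i : ZMod 3} {x : Triod} (h : OnBranch i x) : x ≠ center := by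
  rintro rfl
  exact lt_irrefl _ h

theorem continuous_coord (i : ZMod 3) : Continuous fun x : Triod => x.1 i :=
  (continuous_apply i).comp continuous_subtype_val

/-- The point of the branch `i` at distance `t` from `a`; the parameter is truncated to
`[0, 1]`, so that `leg i` is defined and continuous on all of `ℝ`. -/
noncomputable def leg (i : ZMod 3) (t : ℝ) : Triod :=
  ⟨Pi.single i (max 0 (min t 1)), fun k => by
    by_cases hk : k = i
    · subst hk; simp
    · simp [hk], fun k l hkl => by
    by_cases hk : k = i
    · exact Or.inr (Pi.single_eq_of_ne (fun h : l = i => hkl (hk.trans h.symm)) _)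
    · exact Or.inl (Pi.single_eq_of_ne hk _)⟩

theorem leg_same (i : ZMod 3) {t : ℝ} (h0 : 0 ≤ t) (h1 : t ≤ 1) : (leg i t).1 i = t := by
  simp [leg, h0, h1]

theorem leg_of_ne {i k : ZMod 3} (h : k ≠ i) (t : ℝ) : (leg i t).1 k = 0 := by
  simp [leg, h]

theorem leg_of_nonpos (i : ZMod 3) {t : ℝ} (h : t ≤ 0) : leg i t = center := by
  refine ext_coord fun k => ?_
  by_cases hk : k = i
  · subst hk
    simp [leg, center, h]
  · rw [leg_of_ne hk]; rfl

theorem continuous_leg (i : ZMod 3) : Continuous (leg i) := by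
  refine Continuous.subtype_mk (continuous_pi fun k => ?_) _
  by_cases hk : k = i
  · subst hk; simp only [Pi.single_eq_same]; fun_prop
  · simp only [Pi.single_apply, hk, if_false]; fun_prop

theorem OnBranch.leg_coord {i : ZMod 3} {x : Triod} (h : OnBranch i x) : leg i (x.1 i) = x :=
  (h.ext (leg_same i (x.2.1 i).1 (x.2.1 i).2).symm).symm

theorem between_iff {x z y : Triod} :
    Between x z y ↔ ∀ k, z.1 k ∈ uIcc (x.1 k) (y.1 k) := by
  have key : ∀ k, z.1 k ∈ uIcc (x.1 k) (y.1 k) ↔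
      |x.1 k - y.1 k| = |x.1 k - z.1 k| + |z.1 k - y.1 k| := by
    intro k
    rw [mem_uIcc]
    constructor
    · rintro (⟨h1, h2⟩ | ⟨h1, h2⟩)
      · rw [abs_of_nonpos, abs_of_nonpos, abs_of_nonpos] <;> linarith
      · rw [abs_of_nonneg, abs_of_nonneg, abs_of_nonneg] <;> linarith
    · intro h
      rcases abs_cases (x.1 k - y.1 k) with h1 | h1 <;>
      rcases abs_cases (x.1 k - z.1 k) with h2 | h2 <;>
      rcases abs_cases (z.1 k - y.1 k) with h3 | h3 <;>
      first
      | (left; constructor <;> linarith)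
      | (right; constructor <;> linarith)
  simp only [key]
  unfold Between arcDist
  rw [← Finset.sum_add_distrib, eq_comm,
    Finset.sum_eq_sum_iff_of_le fun k _ => abs_sub_le (x.1 k) (z.1 k) (y.1 k)]
  simp

/-- A point of a branch separates the points closer to `a`, and the other branches, from the
points farther from `a`. -/
theorem mem_of_isPreconnected {C : Set Triod} (hC : IsPreconnected C) {i : ZMod 3}
    {u s w : Triod} (hu : u ∈ C) (hw : w ∈ C) (hs : OnBranch i s) (h1 : u.1 i ≤ s.1 i)
    (h2 : s.1 i ≤ w.1 i) : s ∈ C := by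
  obtain ⟨v, hv, hvs⟩ := hC.intermediate_value hu hw (continuous_coord i).continuousOn ⟨h1, h2⟩
  have : s = v := hs.ext hvs.symm
  rwa [this]

/-- The branching point separates each branch from the others. -/
theorem center_mem_of_isPreconnected {C : Set Triod} (hC : IsPreconnected C) {i : ZMod 3}
    {u w : Triod} (hu : u ∈ C) (hw : w ∈ C) (hiu : OnBranch i u) (hiw : ¬ OnBranch i w) :
    center ∈ C := by
  -- This function is positive on the branch `i`, negative on the other two.
  let g : Triod → ℝ := fun x => 2 * x.1 i - ∑ k, x.1 k
  have hg : Continuous g :=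
    (continuous_const.mul (continuous_coord i)).sub
      (continuous_finsetSum _ fun k _ => continuous_coord k)
  have hsum : ∀ {x : Triod} {k}, OnBranch k x → ∑ l, x.1 l = x.1 k := fun {x k} hx =>
    Finset.sum_eq_single k (fun l _ hl => hx.eq_zero hl) (by simp)
  have h1 : 0 ≤ g u := by
    simp only [g, hsum hiu]
    have : 0 < u.1 i := hiu
    linarith
  have h2 : g w ≤ 0 := by
    have : 0 ≤ ∑ k, w.1 k := Finset.sum_nonneg fun k _ => (w.2.1 k).1
    simp only [g, not_onBranch_iff.1 hiw]
    linarith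
  obtain ⟨v, hv, hv0⟩ := hC.intermediate_value hw hu hg.continuousOn ⟨h2, h1⟩
  have : v = center := by
    by_contra hne
    obtain ⟨k, hk⟩ := exists_onBranch hne
    have hpos : 0 < v.1 k := hk
    simp only [g, hsum hk] at hv0
    by_cases hki : i = k
    · subst hki; linarith
    · rw [hk.eq_zero hki] at hv0; linarith
  rwa [← this]

/-! ### Maps whose only fixed point is the branching point -/

/-- Otherwise there would be a fixed point between `x` and the end of the branch. -/
theorem InU.coord_lt {g : Triod → Triod} (hg : InU g) {i : ZMod 3} {x : Triod}
    (hx : OnBranch i x) : (g x).1 i < x.1 i := by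
  by_contra! h
  have hx0 : 0 < x.1 i := hx
  have hcont : ContinuousOn (fun t => (g (leg i t)).1 i - t) (Icc (x.1 i) 1) :=
    (((continuous_coord i).comp (hg.continuous.comp (continuous_leg i))).sub
      continuous_id).continuousOn
  obtain ⟨t, ht, ht0⟩ := intermediate_value_Icc' (x.2.1 i).2 hcont
    (show (0 : ℝ) ∈ _ from
      ⟨sub_nonpos.2 ((g (leg i 1)).2.1 i).2, by simp only [hx.leg_coord]; linarith⟩)
  have htp : 0 < t := hx0.trans_le ht.1
  have hleg := leg_same i htp.le ht.2
  have hb : OnBranch i (leg i t) := by rw [OnBranch, hleg]; exact htp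
  have : leg i t = g (leg i t) := hb.ext (by rw [hleg]; simp only at ht0; linarith)
  exact hb.ne_center ((hg.fixed_iff _).1 this.symm)

/-- If a map in `𝒰` carries `p` to the branch of `q`, not closer to `a` than `q`, and `q` to the
branch of `p`, not closer to `a` than `p`, then it interchanges two points of these branches.
Identify the union of the two branches with an interval and collapse the third branch:
if `y` lies between `a` and `p` and is mapped to `q`, the second iterate pushes `y`
away from `a`, so it has a fixed point between `y` and the end of the branch. -/
theorem InU.exists_two_cycle {g : Triod → Triod} (hg : InU g) {i j : ZMod 3} (hij : i ≠ j)
    {p q : Triod} (hp : OnBranch i p) (hq : OnBranch j q) (hpq : q.1 j ≤ (g p).1 j)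
    (hqp : p.1 i ≤ (g q).1 i) :
    ∃ x, OnBranch i x ∧ OnBranch j (g x) ∧ g (g x) = x := by
  have hp0 : 0 < p.1 i := hp
  have hq0 : 0 < q.1 j := hq
  have hga : g center = center := (hg.fixed_iff _).2 rfl
  let L : ℝ → Triod := fun t => if t ≤ 0 then leg i (-t) else leg j t
  have hL : Continuous L := by
    refine Continuous.if_le ((continuous_leg i).comp continuous_neg) (continuous_leg j)
      continuous_id continuous_const ?_
    rintro t rfl
    simp [leg_of_nonpos]
  let c : Triod → ℝ := fun x => x.1 j - x.1 i
  have hc : Continuous c := (continuous_coord j).sub (continuous_coord i)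
  let F : ℝ → ℝ := fun t => c (g (L t))
  have hF : Continuous F := hc.comp (hg.continuous.comp hL)
  have hL0 : L 0 = center := by simp [L, leg_of_nonpos]
  have hF0 : F 0 = 0 := by simp only [F, hL0, hga]; simp [c, center]
  have hLneg : ∀ {t : ℝ}, t ≤ 0 → L t = leg i (-t) := fun {t} ht => by simp only [L, if_pos ht]
  have hLpos : ∀ {t : ℝ}, 0 < t → L t = leg j t := fun {t} ht => by
    simp only [L, if_neg (not_le.2 ht)]
  have hFle : ∀ t, -1 ≤ F t := fun t => by
    have h1 := ((g (L t)).2.1 i).2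
    have h2 := ((g (L t)).2.1 j).1
    simp only [F, c]; linarith
  have hgt : ∀ {t : ℝ}, -1 ≤ t → t < 0 → t < F t := by
    intro t h1 h0
    have hl := leg_same i (t := -t) (by linarith) (by linarith)
    have hb : OnBranch i (L t) := by rw [hLneg h0.le, OnBranch, hl]; linarith
    have h2 := hg.coord_lt hb
    rw [hLneg h0.le, hl, ← hLneg h0.le] at h2
    have h3 := ((g (L t)).2.1 j).1
    simp only [F, c]; linarith
  have hLp : L (-p.1 i) = p := by rw [hLneg (by linarith), neg_neg, hp.leg_coord]
  have hLq : L (q.1 j) = q := by rw [hLpos hq0, hq.leg_coord]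
  have hgpj : OnBranch j (g p) := hq0.trans_le hpq
  have hgqi : OnBranch i (g q) := hp0.trans_le hqp
  have hFp : q.1 j ≤ F (-p.1 i) := by
    simp only [F, hLp, c, hgpj.eq_zero hij, sub_zero, hpq]
  have hFq : F (q.1 j) ≤ -p.1 i := by
    simp only [F, hLq, c, hgqi.eq_zero hij.symm, zero_sub]; linarith
  obtain ⟨y, hy, hyq⟩ := intermediate_value_Icc' (show -p.1 i ≤ 0 by linarith) hF.continuousOn
    (show q.1 j ∈ Icc (F 0) (F (-p.1 i)) from ⟨by rw [hF0]; exact hq0.le, hFp⟩)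
  have hy0 : y < 0 := lt_of_le_of_ne hy.2 (by rintro rfl; rw [hF0] at hyq; exact hq0.ne hyq)
  have hp1 := (p.2.1 i).2
  obtain ⟨x, hx, hx0⟩ := intermediate_value_Icc' (show -1 ≤ y by linarith [hy.1])
    ((hF.comp hF).sub continuous_id).continuousOn
    (show (0 : ℝ) ∈ _ from ⟨by simp only [comp, hyq, Pi.sub_apply, id]; linarith [hy.1], by
      simp only [comp, Pi.sub_apply, id]; linarith [hFle (F (-1))]⟩)
  have hFF : F (F x) = x := by simp only [comp, Pi.sub_apply, id] at hx0; linarith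
  have hxneg : x < 0 := hx.2.trans_lt hy0
  have hFx : 0 < F x := by
    by_contra! hle
    rcases hle.lt_or_eq with h | h
    · have h1 := hgt (hFle x) h
      have h2 := hgt hx.1 hxneg
      linarith
    · rw [h, hF0] at hFF; linarith
  have hl := leg_same i (t := -x) (by linarith) (by linarith [hx.1])
  have hbj : OnBranch j (g (L x)) := by
    by_contra hn
    have h0 := not_onBranch_iff.1 hn
    have h1 := ((g (L x)).2.1 i).1
    simp only [F, c, h0] at hFx; linarith
  have hLF : L (F x) = g (L x) := by
    rw [hLpos hFx]
    simp only [F, c, hbj.eq_zero hij, sub_zero, hbj.leg_coord]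
  have hbx : OnBranch i (L x) := by rw [hLneg hxneg.le, OnBranch, hl]; linarith
  have hFF' : c (g (g (L x))) = x := by rw [← hLF]; exact hFF
  have hbi : OnBranch i (g (g (L x))) := by
    by_contra hn
    have h0 := not_onBranch_iff.1 hn
    have h1 := ((g (g (L x))).2.1 j).1
    simp only [c, h0] at hFF'; linarith
  refine ⟨L x, hbx, hbj, hbi.ext ?_⟩
  rw [hLneg hxneg.le, hl, ← hLneg hxneg.le]
  simp only [c, hbi.eq_zero hij.symm] at hFF'
  linarith

/-! ### Cycles and patterns -/

theorem IsCycle.finite {f : Triod → Triod} {P : Set Triod} (h : IsCycle f P) : P.Finite := by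
  obtain ⟨-, x, ⟨n, hn, hx⟩, rfl⟩ := h
  refine ((finite_lt_nat n).image fun k => f^[k] x).subset ?_
  rintro _ ⟨k, rfl⟩
  exact ⟨k % n, Nat.mod_lt _ hn, hx.iterate_mod_apply k⟩

theorem IsCycle.mapsTo {f : Triod → Triod} {P : Set Triod} (h : IsCycle f P) :
    MapsTo f P P := by
  obtain ⟨-, x, -, rfl⟩ := h
  rintro _ ⟨k, rfl⟩
  exact ⟨k + 1, iterate_succ_apply' f k x⟩

theorem IsCycle.injOn {f : Triod → Triod} {P : Set Triod} (h : IsCycle f P) : InjOn f P := by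
  have hs : SurjOn f P P := by
    obtain ⟨-, x, ⟨n, hn, hx⟩, rfl⟩ := h
    rintro _ ⟨k, rfl⟩
    refine ⟨f^[k + (n - 1)] x, ⟨_, rfl⟩, ?_⟩
    have hkn : k + (n - 1) + 1 = k + n := by omega
    rw [← iterate_succ_apply' f, Nat.succ_eq_add_one, hkn, iterate_add_apply, hx.eq]
  exact ((h.finite.surjOn_iff_bijOn_of_mapsTo h.mapsTo).1 hs).injOn

theorem IsCycle.nonempty {f : Triod → Triod} {P : Set Triod} (h : IsCycle f P) :
    P.Nonempty := by
  obtain ⟨-, x, -, rfl⟩ := h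
  exact ⟨_, 0, rfl⟩

theorem IsCycle.ne_center {f : Triod → Triod} {P : Set Triod} (h : IsCycle f P) {x : Triod}
    (hx : x ∈ P) : x ≠ center := fun e => h.1 (e ▸ hx)

theorem IsCycle.exists_onBranch {f : Triod → Triod} {P : Set Triod} (h : IsCycle f P)
    {x : Triod} (hx : x ∈ P) : ∃ i, OnBranch i x := Triod.exists_onBranch (h.ne_center hx)

theorem subset_hull (P : Set Triod) : P ⊆ hull P :=
  fun x hx => ⟨x, hx, x, hx, between_iff.2 fun _ => by simp⟩

/-- If `P` meets two branches, its hull contains the arcs from `a` to the points of `P`. -/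
theorem mem_hull_of_coord_le {P : Set Triod} {i j : ZMod 3} (hij : i ≠ j) {p q : Triod}
    (hp : p ∈ P) (hip : OnBranch i p) (hq : q ∈ P) (hjq : OnBranch j q) {z : Triod}
    (hz : ∀ k, k ≠ i → z.1 k = 0) (hle : z.1 i ≤ p.1 i) : z ∈ hull P := by
  refine ⟨p, hp, q, hq, between_iff.2 fun k => ?_⟩
  by_cases hk : k = i
  · subst hk
    rw [hjq.eq_zero hij]
    exact mem_uIcc_of_ge (z.2.1 k).1 hle
  · rw [hip.eq_zero hk, hz k hk]
    exact mem_uIcc_of_le le_rfl (q.2.1 k).1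

theorem isCycle_pair {g : Triod → Triod} {x y : Triod} (hx : x ≠ center) (hy : y ≠ center)
    (hxy : g x = y) (hyx : g y = x) : IsCycle g {x, y} := by
  have h2 : IsPeriodicPt g 2 x := by
    change g (g x) = x
    rw [hxy, hyx]
  refine ⟨by simp [hx.symm, hy.symm], x, ⟨2, by norm_num, h2⟩, ?_⟩
  ext z
  constructor
  · rintro (rfl | rfl)
    · exact ⟨0, rfl⟩
    · exact ⟨1, hxy⟩
  · rintro ⟨k, rfl⟩
    have h := h2.iterate_mod_apply k
    rcases Nat.mod_two_eq_zero_or_one k with hk | hk <;> rw [hk] at h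
    · left; exact h.symm
    · right; exact h.symm.trans hxy

theorem mem_hull_pair_iff {i j : ZMod 3} (hij : i ≠ j) {x y : Triod} (hx : OnBranch i x)
    (hy : OnBranch j y) (z : Triod) :
    z ∈ hull {x, y} ↔ z.1 i ≤ x.1 i ∧ z.1 j ≤ y.1 j ∧ ∀ k, k ≠ i → k ≠ j → z.1 k = 0 := by
  have hx0 : 0 < x.1 i := hx
  have hy0 : 0 < y.1 j := hy
  have hxj := hx.eq_zero hij.symm
  have hyi := hy.eq_zero hij
  constructor
  · rintro ⟨u, hu, w, hw, h⟩
    rw [between_iff] at h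
    refine ⟨(h i).2.trans ?_, (h j).2.trans ?_, fun k hki hkj => ?_⟩
    · rcases hu with rfl | rfl <;> rcases hw with rfl | rfl <;> simp [hyi, hx0.le]
    · rcases hu with rfl | rfl <;> rcases hw with rfl | rfl <;> simp [hxj, hy0.le]
    · have := h k
      rcases hu with rfl | rfl <;> rcases hw with rfl | rfl <;>
        simpa [hx.eq_zero hki, hy.eq_zero hkj] using this
  · rintro ⟨h1, h2, h3⟩
    refine ⟨x, by simp, y, by simp, between_iff.2 fun k => ?_⟩
    by_cases hki : k = i
    · subst hki
      rw [hyi]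
      exact mem_uIcc_of_ge (z.2.1 k).1 h1
    by_cases hkj : k = j
    · subst hkj
      rw [hxj]
      exact mem_uIcc_of_le (z.2.1 k).1 h2
    rw [h3 k hki hkj, hx.eq_zero hki, hy.eq_zero hkj]
    simp

/-- The map between the hulls of two pairs of points of the branches `i`, `j` that is linear on
each of these branches. -/
noncomputable def pairMap {i j : ZMod 3} (hij : i ≠ j) {x y x' y' : Triod} (hx : OnBranch i x)
    (hy : OnBranch j y) (hx' : OnBranch i x') (hy' : OnBranch j y') (z : hull {x, y}) :
    hull {x', y'} :=
  have key : ∀ {s t u : ℝ}, 0 ≤ s → s ≤ t → 0 < t → 0 ≤ u → 0 ≤ s / t * u ∧ s / t * u ≤ u :=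
    fun {s t u} h0 hst ht hu => ⟨by positivity, mul_le_of_le_one_left hu ((div_le_one ht).2 hst)⟩
  have hz := (mem_hull_pair_iff hij hx hy z.1).1 z.2
  have hi := key (z.1.2.1 i).1 hz.1 hx (x'.2.1 i).1
  have hj := key (z.1.2.1 j).1 hz.2.1 hy (y'.2.1 j).1
  have h0 : ∀ k l, k ≠ l → z.1.1 k = 0 ∨ z.1.1 l = 0 := z.1.2.2
  let w : ZMod 3 → ℝ := fun k => if k = i then z.1.1 i / x.1 i * x'.1 i else
    if k = j then z.1.1 j / y.1 j * y'.1 j else 0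
  have hw0 : ∀ k, z.1.1 k = 0 → w k = 0 := fun k hk => by
    simp only [w]
    split_ifs with h1 h2
    · rw [← h1, hk]; simp
    · rw [← h2, hk]; simp
    · rfl
  ⟨⟨w, fun k => by
      simp only [w]
      split_ifs
      · exact ⟨hi.1, hi.2.trans (x'.2.1 i).2⟩
      · exact ⟨hj.1, hj.2.trans (y'.2.1 j).2⟩
      · simp,
    fun k l hkl => (h0 k l hkl).imp (hw0 k) (hw0 l)⟩,
  (mem_hull_pair_iff hij hx' hy' _).2 ⟨by simpa [w] using hi.2, by
    simpa [w, hij.symm] using hj.2, fun k hki hkj => by simp [w, hki, hkj]⟩⟩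

section pairMap

variable {i j : ZMod 3} (hij : i ≠ j) {x y x' y' : Triod} (hx : OnBranch i x)
    (hy : OnBranch j y) (hx' : OnBranch i x') (hy' : OnBranch j y')

theorem pairMap_left (z : hull {x, y}) :
    (pairMap hij hx hy hx' hy' z).1.1 i = z.1.1 i / x.1 i * x'.1 i := by
  simp [pairMap]

theorem pairMap_right (z : hull {x, y}) :
    (pairMap hij hx hy hx' hy' z).1.1 j = z.1.1 j / y.1 j * y'.1 j := by
  simp [pairMap, hij.symm]

theorem pairMap_other (z : hull {x, y}) {k : ZMod 3} (hi : k ≠ i) (hj : k ≠ j) :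
    (pairMap hij hx hy hx' hy' z).1.1 k = 0 := by
  simp [pairMap, hi, hj]

theorem continuous_pairMap : Continuous (pairMap hij hx hy hx' hy') := by
  have hc : ∀ k, Continuous fun z : hull {x, y} => z.1.1 k :=
    fun k => (continuous_coord k).comp continuous_subtype_val
  refine Continuous.subtype_mk (Continuous.subtype_mk (continuous_pi fun k => ?_) _) _
  by_cases hki : k = i
  · simp only [hki, if_true]
    exact ((hc i).div_const _).mul continuous_const
  by_cases hkj : k = j
  · simp only [hkj, hij.symm, if_true, if_false]
    exact ((hc j).div_const _).mul continuous_const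
  · simp only [hki, hkj, if_false]
    exact continuous_const

theorem pairMap_pairMap (z : hull {x, y}) :
    pairMap hij hx' hy' hx hy (pairMap hij hx hy hx' hy' z) = z := by
  have h1 : x.1 i ≠ 0 := ne_of_gt hx
  have h2 : y.1 j ≠ 0 := ne_of_gt hy
  have h3 : x'.1 i ≠ 0 := ne_of_gt hx'
  have h4 : y'.1 j ≠ 0 := ne_of_gt hy'
  refine Subtype.ext (ext_coord fun k => ?_)
  by_cases hki : k = i
  · subst hki
    rw [pairMap_left, pairMap_left]
    field_simp
  by_cases hkj : k = j
  · subst hkj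
    rw [pairMap_right, pairMap_right]
    field_simp
  · rw [pairMap_other _ _ _ _ _ _ hki hkj,
      ((mem_hull_pair_iff hij hx hy z.1).1 z.2).2.2 k hki hkj]

theorem pairMap_apply_left (z : hull {x, y}) (hz : z.1 = x) :
    (pairMap hij hx hy hx' hy' z).1 = x' := by
  have h1 : x.1 i ≠ 0 := ne_of_gt hx
  refine (hx'.ext ?_).symm
  rw [pairMap_left, hz, div_self h1, one_mul]

theorem pairMap_apply_right (z : hull {x, y}) (hz : z.1 = y) :
    (pairMap hij hx hy hx' hy' z).1 = y' := by
  have h1 : y.1 j ≠ 0 := ne_of_gt hy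
  refine (hy'.ext ?_).symm
  rw [pairMap_right, hz, div_self h1, one_mul]

theorem pairMap_mem (z : hull {x, y}) (hz : z.1 ∈ ({x, y} : Set Triod)) :
    (pairMap hij hx hy hx' hy' z).1 ∈ ({x', y'} : Set Triod) := by
  rcases hz with h | h
  · exact Or.inl (pairMap_apply_left hij hx hy hx' hy' z h)
  · exact Or.inr (pairMap_apply_right hij hx hy hx' hy' z h)

theorem onBranch_pairMap (z : hull {x, y}) {k : ZMod 3} (hz : OnBranch k z.1) :
    OnBranch k (pairMap hij hx hy hx' hy' z).1 := by
  have hz0 : 0 < z.1.1 k := hz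
  have h1 : 0 < x.1 i := hx
  have h2 : 0 < y.1 j := hy
  have h3 : 0 < x'.1 i := hx'
  have h4 : 0 < y'.1 j := hy'
  unfold OnBranch
  by_cases hki : k = i
  · subst hki
    rw [pairMap_left]
    positivity
  by_cases hkj : k = j
  · subst hkj
    rw [pairMap_right]
    positivity
  · exact absurd (((mem_hull_pair_iff hij hx hy z.1).1 z.2).2.2 k hki hkj) hz0.ne'

end pairMap

/-- All 2-cycles with one point on the branch `i` and one on the branch `j` have the same
pattern. -/
theorem samePattern_pair {i j : ZMod 3} (hij : i ≠ j) {x y x' y' : Triod} (hx : OnBranch i x)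
    (hy : OnBranch j y) (hx' : OnBranch i x') (hy' : OnBranch j y') {f g : Triod → Triod}
    (hf : f x = y) (hf' : f y = x) (hg : g x' = y') (hg' : g y' = x') :
    SamePattern f {x, y} g {x', y'} := by
  let h : hull {x, y} ≃ₜ hull {x', y'} :=
    { toFun := pairMap hij hx hy hx' hy'
      invFun := pairMap hij hx' hy' hx hy
      left_inv := pairMap_pairMap hij hx hy hx' hy'
      right_inv := pairMap_pairMap hij hx' hy' hx hy
      continuous_toFun := continuous_pairMap hij hx hy hx' hy'
      continuous_invFun := continuous_pairMap hij hx' hy' hx hy }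
  have hinv : ∀ z, pairMap hij hx' hy' hx hy (h z) = z := pairMap_pairMap hij hx hy hx' hy'
  refine ⟨h, fun k z => ⟨fun hz => ?_, onBranch_pairMap hij hx hy hx' hy' z⟩,
    fun z => ⟨fun hz => ?_, pairMap_mem hij hx hy hx' hy' z⟩, fun u v hu huv => ?_⟩
  · rw [← hinv z]
    exact onBranch_pairMap hij hx' hy' hx hy _ hz
  · rw [← hinv z]
    exact pairMap_mem hij hx' hy' hx hy _ hz
  · rcases hu with hu | hu
    · rw [hu, hf] at huv
      rw [show (h u).1 = x' from pairMap_apply_left hij hx hy hx' hy' u hu,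
        show (h v).1 = y' from pairMap_apply_right hij hx hy hx' hy' v huv, hg]
    · rw [hu, hf'] at huv
      rw [show (h u).1 = y' from pairMap_apply_right hij hx hy hx' hy' u hu,
        show (h v).1 = x' from pairMap_apply_left hij hx hy hx' hy' v huv, hg']

/-- The map interchanging the branches `i` and `j` and collapsing the third one. -/
def swapMap (i j : ZMod 3) (hij : i ≠ j) (v : Triod) : Triod :=
  ⟨fun k => if k = i then v.1 j else if k = j then v.1 i else 0, fun k => by
    dsimp only
    split_ifs
    · exact v.2.1 j
    · exact v.2.1 i
    · simp, fun k l hkl => by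
    have h1 := v.2.2 i j hij
    by_cases hki : k = i <;> by_cases hkj : k = j <;> by_cases hli : l = i <;>
      by_cases hlj : l = j <;> simp_all [or_comm]⟩

theorem inU_swapMap {i j : ZMod 3} (hij : i ≠ j) : InU (swapMap i j hij) := by
  refine ⟨Continuous.subtype_mk (continuous_pi fun k => ?_) _, fun v => ⟨fun h => ?_, ?_⟩⟩
  · split_ifs
    · exact continuous_coord j
    · exact continuous_coord i
    · exact continuous_const
  · by_contra hv
    obtain ⟨k, hk⟩ := exists_onBranch hv
    have hk0 : v.1 k ≠ 0 := ne_of_gt hk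
    have h1 := congrArg (fun w : Triod => w.1 k) h
    simp only [swapMap] at h1
    split_ifs at h1 with hki hkj
    · subst hki; exact hk0 (h1.symm.trans (hk.eq_zero hij.symm))
    · subst hkj; exact hk0 (h1.symm.trans (hk.eq_zero hij))
    · exact hk0 h1.symm
  · rintro rfl
    refine ext_coord fun k => ?_
    simp [swapMap, center]

/-- The pattern of a regular cycle is exhibited by a map in `𝒰` that interchanges no two points
of the given branches. -/
theorem IsRegular.exists_map {f : Triod → Triod} {P : Set Triod} (h : IsRegular f P)
    {i j : ZMod 3} (hij : i ≠ j) :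
    ∃ g Q, InU g ∧ IsCycle g Q ∧ SamePattern f P g Q ∧
      ∀ x, OnBranch i x → OnBranch j (g x) → g (g x) ≠ x := by
  have hli := leg_same i zero_le_one le_rfl
  have hlj := leg_same j zero_le_one le_rfl
  have hi : OnBranch i (leg i 1) := by rw [OnBranch, hli]; exact one_pos
  have hj : OnBranch j (leg j 1) := by rw [OnBranch, hlj]; exact one_pos
  have hs1 : swapMap i j hij (leg i 1) = leg j 1 := by
    refine (hj.ext ?_).symm
    simp [swapMap, hij.symm, hli, hlj]
  have hs2 : swapMap i j hij (leg j 1) = leg i 1 := by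
    refine (hi.ext ?_).symm
    simp [swapMap, hli, hlj]
  have hne : leg i 1 ≠ leg j 1 := fun e => hij (hi.unique (e ▸ hj))
  have hprim : IsPrimitive {leg i 1, leg j 1} := by
    rintro x (rfl | rfl) y (rfl | rfl) k hx hy
    · rfl
    · exact absurd ((hi.unique hx).trans (hy.unique hj)) hij
    · exact absurd ((hi.unique hy).trans (hx.unique hj)) hij
    · rfl
  have := h (swapMap i j hij) {leg i 1, leg j 1} (inU_swapMap hij)
    (isCycle_pair hi.ne_center hj.ne_center hs1 hs2) hprim (ncard_pair hne)
  unfold Forces at this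
  push Not at this
  obtain ⟨g, hg, ⟨Q, hQ, hPQ⟩, hR⟩ := this
  exact ⟨g, Q, hg, hQ, hPQ, fun x hx hgx hgg => hR {x, g x}
    (isCycle_pair hx.ne_center hgx.ne_center rfl hgg)
    (samePattern_pair hij hi hj hx hgx hs1 hs2 rfl hgg)⟩

/-- A homeomorphism of hulls that fixes each branch preserves the order of the points on each
branch, provided the cycle meets two branches. -/
theorem SamePattern.exists_equiv {f g : Triod → Triod} {P Q : Set Triod} (hfP : MapsTo f P P)
    (h : SamePattern f P g Q) :
    ∃ θ : Triod → Triod, (∀ p ∈ P, θ p ∈ Q) ∧ (∀ q ∈ Q, ∃ p ∈ P, θ p = q) ∧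
      (∀ p ∈ P, ∀ i, OnBranch i (θ p) ↔ OnBranch i p) ∧
      (∀ p ∈ P, θ (f p) = g (θ p)) ∧
      ∀ i j, i ≠ j → ∀ p ∈ P, ∀ p' ∈ P, ∀ p'' ∈ P, OnBranch i p → OnBranch i p' →
        OnBranch j p'' → p.1 i ≤ p'.1 i → (θ p).1 i ≤ (θ p').1 i := by
  classical
  obtain ⟨h, hbr, hmem, hconj⟩ := h
  let θ : Triod → Triod := fun x => if hx : x ∈ hull P then (h ⟨x, hx⟩).1 else x
  have hθ : ∀ p (hp : p ∈ hull P), θ p = (h ⟨p, hp⟩).1 := fun p hp => by simp only [θ, dif_pos hp]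
  have hPh := subset_hull P
  refine ⟨θ, fun p hp => ?_, fun q hq => ?_, fun p hp i => ?_, fun p hp => ?_, ?_⟩
  · rw [hθ p (hPh hp)]
    exact (hmem _).2 hp
  · obtain ⟨z, hz⟩ := h.surjective ⟨q, subset_hull Q hq⟩
    refine ⟨z.1, (hmem z).1 (by rw [hz]; exact hq), ?_⟩
    rw [hθ z.1 z.2, Subtype.coe_eta, hz]
  · rw [hθ p (hPh hp)]
    exact hbr i _
  · rw [hθ p (hPh hp), hθ (f p) (hPh (hfP hp))]
    exact hconj _ _ hp rfl
  · intro i j hij p hp p' hp' p'' hp'' hip hip' hjp'' hle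
    by_contra! hlt
    rw [hθ p (hPh hp), hθ p' (hPh hp')] at hlt
    -- The image of the arc from `a` to `p` joins `a` to the image of `p`.
    let C : Set (hull P) := Subtype.val ⁻¹' (leg i '' Icc 0 (p.1 i))
    have hsub : leg i '' Icc 0 (p.1 i) ⊆ hull P := by
      rintro _ ⟨t, ht, rfl⟩
      refine mem_hull_of_coord_le hij hp hip hp'' hjp'' (fun k hk => leg_of_ne hk t) ?_
      rw [leg_same i ht.1 (ht.2.trans (p.2.1 i).2)]
      exact ht.2
    have hC : IsPreconnected C := by
      rw [← Topology.IsInducing.subtypeVal.isPreconnected_image, Subtype.image_preimage_coe,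
        inter_eq_right.2 hsub]
      exact isPreconnected_Icc.image _ (continuous_leg i).continuousOn
    have hD : IsPreconnected ((fun z => (h z).1) '' C) :=
      hC.image _ (continuous_subtype_val.comp h.continuous).continuousOn
    have hc : center ∈ leg i '' Icc 0 (p.1 i) :=
      ⟨0, ⟨le_rfl, (p.2.1 i).1⟩, leg_of_nonpos i le_rfl⟩
    have hpC : p ∈ leg i '' Icc 0 (p.1 i) := ⟨p.1 i, ⟨(p.2.1 i).1, le_rfl⟩, hip.leg_coord⟩
    have h0 : (h ⟨center, hsub hc⟩).1.1 i = 0 :=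
      not_onBranch_iff.1 fun hb => lt_irrefl _ ((hbr i ⟨center, hsub hc⟩).1 hb)
    obtain ⟨z, ⟨t, ht, htz⟩, hzp⟩ := mem_of_isPreconnected hD
      ⟨⟨center, hsub hc⟩, hc, rfl⟩ ⟨⟨p, hPh hp⟩, hpC, rfl⟩ ((hbr i ⟨p', hPh hp'⟩).2 hip')
      (by simp only [h0]; exact ((h ⟨p', hPh hp'⟩).1.2.1 i).1) hlt.le
    have hzp' : z = ⟨p', hPh hp'⟩ := h.injective (Subtype.ext hzp)
    have hcoord : p'.1 i ≤ p.1 i := by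
      have : p' = leg i t := by rw [htz, hzp']
      rw [this, leg_same i ht.1 (ht.2.trans (p.2.1 i).2)]
      exact ht.2
    have : p = p' := hip.ext (le_antisymm hle hcoord)
    subst this
    exact lt_irrefl _ hlt

/-- The point `p` of `P` is the one closest to `a` on the branch `i`. -/
def IsClosest (P : Set Triod) (i : ZMod 3) (p : Triod) : Prop :=
  p ∈ P ∧ OnBranch i p ∧ ∀ q ∈ P, OnBranch i q → p.1 i ≤ q.1 i

theorem exists_isClosest {P : Set Triod} (hP : P.Finite) {i : ZMod 3} {x : Triod} (hx : x ∈ P)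
    (hi : OnBranch i x) : ∃ p, IsClosest P i p := by
  obtain ⟨p, hp, hmin⟩ := exists_min_image {q ∈ P | OnBranch i q} (fun q => q.1 i)
    (hP.subset (sep_subset _ _)) ⟨x, hx, hi⟩
  exact ⟨p, hp.1, hp.2, fun q hq hiq => hmin q ⟨hq, hiq⟩⟩

theorem IsRegular.closest_not_green {f : Triod → Triod} {P : Set Triod} (hP : IsCycle f P)
    (h : IsRegular f P) {i : ZMod 3} {p : Triod} (hp : IsClosest P i p) :
    ¬ OnBranch i (f p) := by
  intro hfp
  obtain ⟨g, Q, hg, hQ, hPQ, -⟩ := h.exists_map (i := i) (j := i + 1)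
    ((by decide : ∀ i : ZMod 3, i ≠ i + 1) i)
  obtain ⟨θ, hmem, hsurj, hbr, hconj, hmono⟩ := hPQ.exists_equiv hP.mapsTo
  obtain ⟨hpP, hip, hmin⟩ := hp
  -- A closest point of `Q` is not mapped to its own branch, so `P` meets another branch.
  obtain ⟨q, hqQ, hiq, hqmin⟩ := exists_isClosest hQ.finite (hmem p hpP) ((hbr p hpP i).2 hip)
  have hgq : ¬ OnBranch i (g q) := fun hb =>
    (hg.coord_lt hiq).not_ge (hqmin _ (hQ.mapsTo hqQ) hb)
  obtain ⟨p', hp', rfl⟩ := hsurj q hqQ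
  rw [← hconj p' hp', hbr _ (hP.mapsTo hp')] at hgq
  obtain ⟨j, hj⟩ := hP.exists_onBranch (hP.mapsTo hp')
  have hij : i ≠ j := by rintro rfl; exact hgq hj
  have h1 := hmono i j hij p hpP (f p) (hP.mapsTo hpP) (f p') (hP.mapsTo hp') hip hfp hj
    (hmin _ (hP.mapsTo hpP) hfp)
  rw [hconj p hpP] at h1
  exact (hg.coord_lt ((hbr p hpP i).2 hip)).not_ge h1

theorem IsRegular.closest_not_interchanged {f : Triod → Triod} {P : Set Triod}
    (hP : IsCycle f P) (h : IsRegular f P) {i j : ZMod 3} (hij : i ≠ j) {p q : Triod}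
    (hp : IsClosest P i p) (hq : IsClosest P j q) (hfp : OnBranch j (f p)) :
    ¬ OnBranch i (f q) := by
  intro hfq
  obtain ⟨g, Q, hg, hQ, hPQ, hno⟩ := h.exists_map hij
  obtain ⟨θ, hmem, hsurj, hbr, hconj, hmono⟩ := hPQ.exists_equiv hP.mapsTo
  obtain ⟨hpP, hip, hpmin⟩ := hp
  obtain ⟨hqP, hjq, hqmin⟩ := hq
  have h1 := hmono j i hij.symm q hqP (f p) (hP.mapsTo hpP) p hpP hjq hfp hip
    (hqmin _ (hP.mapsTo hpP) hfp)
  have h2 := hmono i j hij p hpP (f q) (hP.mapsTo hqP) q hqP hip hfq hjq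
    (hpmin _ (hP.mapsTo hqP) hfq)
  rw [hconj p hpP] at h1
  rw [hconj q hqP] at h2
  obtain ⟨x, hx, hgx, hgg⟩ := hg.exists_two_cycle hij ((hbr p hpP i).2 hip)
    ((hbr q hqP j).2 hjq) h1 h2
  exact hno x hx hgx hgg

/-- A regular cycle has a canonical ordering of the branches: the map on branches given by the
images of the points closest to `a` has neither fixed points nor cycles of length 2, so that it
is a cyclic permutation of all three branches. -/
theorem IsRegular.exists_isCanonical {f : Triod → Triod} {P : Set Triod} (hP : IsCycle f P)
    (h : IsRegular f P) : ∃ b, IsCanonical b f P := by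
  have hstep : ∀ i, (∃ p, IsClosest P i p) →
      ∃ j, j ≠ i ∧ (∃ p, IsClosest P j p) ∧ ∀ p, IsClosest P i p → OnBranch j (f p) := by
    rintro i ⟨p, hp⟩
    obtain ⟨j, hj⟩ := hP.exists_onBranch (hP.mapsTo hp.1)
    refine ⟨j, ?_, exists_isClosest hP.finite (hP.mapsTo hp.1) hj, fun q hq => ?_⟩
    · rintro rfl
      exact h.closest_not_green hP hp hj
    · have : q = p := hq.2.1.ext
        (le_antisymm (hq.2.2 p hp.1 hp.2.1) (hp.2.2 q hq.1 hq.2.1))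
      rwa [this]
  obtain ⟨x, hx⟩ := hP.nonempty
  obtain ⟨i, hi⟩ := hP.exists_onBranch hx
  obtain ⟨p₀, h₀⟩ := exists_isClosest hP.finite hx hi
  obtain ⟨j, hji, ⟨p₁, h₁⟩, hf₀⟩ := hstep i ⟨p₀, h₀⟩
  obtain ⟨k, hkj, ⟨p₂, h₂⟩, hf₁⟩ := hstep j ⟨p₁, h₁⟩
  obtain ⟨l, hlk, -, hf₂⟩ := hstep k ⟨p₂, h₂⟩
  have hki : k ≠ i := by
    rintro rfl
    exact h.closest_not_interchanged hP hji.symm h₀ h₁ (hf₀ _ h₀) (hf₁ _ h₁)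
  have hlj : l ≠ j := by
    rintro rfl
    exact h.closest_not_interchanged hP hkj.symm h₁ h₂ (hf₁ _ h₁) (hf₂ _ h₂)
  have hord : ∃ b : Equiv.Perm (ZMod 3), b 0 = i ∧ b 1 = j ∧ b 2 = k ∧ b (2 + 1) = l := by
    clear * - hji hkj hlk hki hlj
    decide +revert
  obtain ⟨b, rfl, rfl, rfl, rfl⟩ := hord
  have hcol : ∀ n p, IsClosest P (b n) p → OnBranch (b (n + 1)) (f p) →
      ∃ p ∈ P, OnBranch (b n) p ∧ (∀ q ∈ P, OnBranch (b n) q → p.1 (b n) ≤ q.1 (b n)) ∧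
        HasColor b f black p :=
    fun n p hp hfp => ⟨p, hp.1, hp.2.1, hp.2.2, n, hp.2.1, hfp⟩
  refine ⟨b, fun n => ?_⟩
  have hn : n = 0 ∨ n = 1 ∨ n = 2 := by decide +revert
  rcases hn with rfl | rfl | rfl
  · exact hcol 0 p₀ h₀ (hf₀ _ h₀)
  · exact hcol 1 p₁ h₁ (hf₁ _ h₁)
  · exact hcol 2 p₂ h₂ (hf₂ _ h₂)

/-! ### Linear maps between consecutive points of a cycle -/

/-- The open interval of the points of the branch `i` (if `0 ≤ α`) whose distance to `a` lies
between `α` and `β`. -/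
def seg (i : ZMod 3) (α β : ℝ) : Set Triod := {x | α < x.1 i ∧ x.1 i < β}

theorem isOpen_seg (i : ZMod 3) (α β : ℝ) : IsOpen (seg i α β) :=
  isOpen_Ioo.preimage (continuous_coord i)

theorem onBranch_of_mem_seg {i : ZMod 3} {α β : ℝ} (hα : 0 ≤ α) {x : Triod}
    (hx : x ∈ seg i α β) : OnBranch i x := hα.trans_lt hx.1

theorem isPreconnected_seg (i : ZMod 3) {α β : ℝ} (hα : 0 ≤ α) :
    IsPreconnected (seg i α β) := by
  have : seg i α β = leg i '' (Ioo α β ∩ Icc 0 1) := by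
    ext x
    constructor
    · intro hx
      exact ⟨x.1 i, ⟨hx, x.2.1 i⟩, (onBranch_of_mem_seg hα hx).leg_coord⟩
    · rintro ⟨t, ⟨ht, ht'⟩, rfl⟩
      unfold seg
      rw [mem_ofPred_eq, leg_same i ht'.1 ht'.2]
      exact ht
  rw [this]
  exact ((ordConnected_Ioo.inter ordConnected_Icc).isPreconnected).image _
    (continuous_leg i).continuousOn

theorem arcDist_eq_zero {x y : Triod} : arcDist x y = 0 ↔ x = y := by
  constructor
  · intro h
    have h' := (Finset.sum_eq_zero_iff_of_nonneg fun k _ => abs_nonneg (x.1 k - y.1 k)).1 h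
    exact ext_coord fun k => sub_eq_zero.1 (abs_eq_zero.1 (h' k (Finset.mem_univ k)))
  · rintro rfl
    simp [arcDist]

/-- `u` and `w` are consecutive elements of `P ∪ {a}` on the branch `i`. -/
structure IsGap (P : Set Triod) (i : ZMod 3) (u w : Triod) : Prop where
  left : u = center ∨ u ∈ P ∧ OnBranch i u
  right : w ∈ P
  lt : u.1 i < w.1 i
  empty : ∀ z ∈ P, z.1 i ≤ u.1 i ∨ w.1 i ≤ z.1 i

theorem IsGap.left_nonneg {P : Set Triod} {i : ZMod 3} {u w : Triod} (_h : IsGap P i u w) :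
    0 ≤ u.1 i := (u.2.1 i).1

theorem IsGap.onBranch {P : Set Triod} {i : ZMod 3} {u w : Triod} (h : IsGap P i u w) :
    OnBranch i w := h.left_nonneg.trans_lt h.lt

theorem IsGap.leg_left {P : Set Triod} {i : ZMod 3} {u w : Triod} (h : IsGap P i u w) :
    leg i (u.1 i) = u := by
  rcases h.left with rfl | ⟨-, hu⟩
  · exact leg_of_nonpos i le_rfl
  · exact hu.leg_coord

theorem exists_isGap {P : Set Triod} (hP : P.Finite) {i : ZMod 3} {x : Triod} (hx : x ∉ P)
    (hi : OnBranch i x) (h : ∃ p ∈ P, x.1 i < p.1 i) :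
    ∃ u w, IsGap P i u w ∧ x ∈ seg i (u.1 i) (w.1 i) := by
  obtain ⟨w, ⟨hw, hxw⟩, hwmin⟩ := exists_min_image {p ∈ P | x.1 i < p.1 i} (fun q => q.1 i)
    (hP.subset (sep_subset _ _)) h
  obtain ⟨u, hu, humax⟩ := exists_max_image
    (insert center {p ∈ P | OnBranch i p ∧ p.1 i < x.1 i}) (fun q => q.1 i)
    ((hP.subset (sep_subset _ _)).insert _) (insert_nonempty _ _)
  have hux : u.1 i < x.1 i := by
    rcases hu with rfl | hu
    · exact hi
    · exact hu.2.2
  refine ⟨u, w, ⟨hu.imp_right fun h => ⟨h.1, h.2.1⟩, hw, hux.trans hxw, fun z hz => ?_⟩,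
    hux, hxw⟩
  rcases lt_trichotomy (z.1 i) (x.1 i) with hlt | heq | hgt
  · left
    by_cases hb : OnBranch i z
    · exact humax z (Or.inr ⟨hz, hb, hlt⟩)
    · rw [not_onBranch_iff.1 hb]
      exact (u.2.1 i).1
  · exact absurd hz (by rwa [← hi.ext heq.symm])
  · exact Or.inr (hwmin z ⟨hz, hgt⟩)

theorem IsLinearFor.injOn_of_isGap {f : Triod → Triod} {P : Set Triod} (hP : IsCycle f P)
    (hb : ∀ i, ∃ p ∈ P, OnBranch i p) (hf : IsLinearFor f P) {i : ZMod 3} {u w : Triod}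
    (h : IsGap P i u w) : InjOn f (seg i (u.1 i) (w.1 i)) := by
  intro x hx y hy hxy
  by_contra hne
  have hsub : seg i (u.1 i) (w.1 i) ⊆ hull P \ (P ∪ {center}) := by
    intro z hz
    have hiz := onBranch_of_mem_seg h.left_nonneg hz
    obtain ⟨q, hq, hjq⟩ := hb (i + 1)
    refine ⟨mem_hull_of_coord_le ((by decide : ∀ i : ZMod 3, i ≠ i + 1) i) h.right h.onBranch
      hq hjq (fun k hk => hiz.eq_zero hk) hz.2.le, ?_⟩
    rintro (hzP | rfl)
    · rcases h.empty z hzP with h1 | h1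
      · exact h1.not_gt hz.1
      · exact h1.not_gt hz.2
    · exact hiz.ne_center rfl
  obtain ⟨c, hc⟩ := hf.affine x (hsub hx)
  have hcomp := (isPreconnected_seg i h.left_nonneg).subset_connectedComponentIn hx hsub
  have hc0 : c = 0 := by
    have h1 := hc x (hcomp hx) y (hcomp hy)
    rw [arcDist_eq_zero.2 hxy] at h1
    exact (mul_eq_zero.1 h1.symm).resolve_right fun h2 => hne (arcDist_eq_zero.1 h2)
  -- The map would be constant on the closed interval, but `f` is injective on `P ∪ {a}`.
  have hconst : ∀ z ∈ seg i (u.1 i) (w.1 i), f z = f x := fun z hz => by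
    have h1 := hc z (hcomp hz) x (hcomp hx)
    rw [hc0, zero_mul] at h1
    exact arcDist_eq_zero.1 h1
  have hclosed : IsClosed {t | f (leg i t) = f x} :=
    isClosed_eq (hf.continuous.comp (continuous_leg i)) continuous_const
  have hIcc : Icc (u.1 i) (w.1 i) ⊆ {t | f (leg i t) = f x} := by
    rw [← closure_Ioo h.lt.ne]
    refine closure_minimal (fun t ht => hconst _ ?_) hclosed
    unfold seg
    rw [mem_ofPred_eq, leg_same i (h.left_nonneg.trans ht.1.le) (ht.2.le.trans (w.2.1 i).2)]
    exact ht
  have hu : f u = f x := by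
    have := hIcc (left_mem_Icc.2 h.lt.le)
    rwa [mem_ofPred_eq, h.leg_left] at this
  have hw : f w = f x := by
    have := hIcc (right_mem_Icc.2 h.lt.le)
    rwa [mem_ofPred_eq, h.onBranch.leg_coord] at this
  rcases h.left with rfl | ⟨huP, -⟩
  · refine hP.ne_center (hP.mapsTo h.right) ?_
    rw [hw, ← hu, hf.map_center]
  · have := hP.injOn huP h.right (hu.trans hw.symm)
    exact h.lt.ne (by rw [this])

/-- Beyond the last point of `P` on a branch, the map is constant. -/
theorem IsLinearFor.eq_of_last {f : Triod → Triod} {P : Set Triod} (hf : IsLinearFor f P)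
    {i : ZMod 3} {p : Triod} (hip : OnBranch i p) (hlast : ∀ q ∈ P, q.1 i ≤ p.1 i)
    {x : Triod} (hx : p.1 i < x.1 i) : f x = f p := by
  have hp0 : 0 < p.1 i := hip
  have hsub : seg i (p.1 i) 2 ⊆ (hull P)ᶜ := by
    rintro z hz ⟨u, hu, w, hw, h⟩
    have h1 := (between_iff.1 h i).2.trans (sup_le (hlast u hu) (hlast w hw))
    exact h1.not_gt hz.1
  have hxs : x ∈ seg i (p.1 i) 2 := ⟨hx, (x.2.1 i).2.trans_lt (by norm_num)⟩
  have hcomp := (isPreconnected_seg i hp0.le).subset_connectedComponentIn hxs hsub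
  have hclosed : IsClosed {t | f (leg i t) = f x} :=
    isClosed_eq (hf.continuous.comp (continuous_leg i)) continuous_const
  have hIcc : Icc (p.1 i) (x.1 i) ⊆ {t | f (leg i t) = f x} := by
    rw [← closure_Ioo hx.ne]
    refine closure_minimal (fun t ht => hf.const x (hsub hxs) _ (hcomp ?_)) hclosed
    have ht1 := ht.2.le.trans (x.2.1 i).2
    unfold seg
    rw [mem_ofPred_eq, leg_same i (hp0.le.trans ht.1.le) ht1]
    exact ⟨ht.1, by linarith⟩
  have := hIcc (left_mem_Icc.2 hx.le)
  rw [mem_ofPred_eq, hip.leg_coord] at this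
  exact this.symm

theorem exists_last {P : Set Triod} (hP : P.Finite) {i : ZMod 3} (h : ∃ p ∈ P, OnBranch i p) :
    ∃ p ∈ P, OnBranch i p ∧ ∀ q ∈ P, q.1 i ≤ p.1 i := by
  obtain ⟨x, hx, hix⟩ := h
  obtain ⟨p, hp, hmax⟩ := exists_max_image P (fun q => q.1 i) hP ⟨x, hx⟩
  exact ⟨p, hp, lt_of_lt_of_le hix (hmax x hx), hmax⟩

theorem IsLinearFor.injOn_or_const {f : Triod → Triod} {P : Set Triod} (hP : IsCycle f P)
    (hb : ∀ i, ∃ p ∈ P, OnBranch i p) (hf : IsLinearFor f P) {i : ZMod 3} {α β : ℝ}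
    (hα : 0 ≤ α) (hK : ∀ p ∈ P, p ∉ seg i α β) :
    InjOn f (seg i α β) ∨ ∃ p ∈ P, ∀ x ∈ seg i α β, f x = f p := by
  by_cases hne : ∃ x, x ∈ seg i α β
  swap
  · exact Or.inl fun x hx => (hne ⟨x, hx⟩).elim
  obtain ⟨x, hx⟩ := hne
  have hix := onBranch_of_mem_seg hα hx
  by_cases habove : ∃ p ∈ P, x.1 i < p.1 i
  · left
    obtain ⟨u, w, hgap, hxuw⟩ := exists_isGap hP.finite (fun hxP => hK x hxP hx) hix habove
    refine (hf.injOn_of_isGap hP hb hgap).mono ?_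
    refine fun z (hz : z ∈ seg i α β) => And.intro (lt_of_le_of_lt ?_ hz.1)
      (lt_of_lt_of_le hz.2 ?_)
    · rcases hgap.left with rfl | ⟨huP, -⟩
      · exact hα
      · by_contra! hlt
        exact hK u huP ⟨hlt, hxuw.1.trans hx.2⟩
    · by_contra! hlt
      exact hK w hgap.right ⟨hx.1.trans hxuw.2, hlt⟩
  · right
    push Not at habove
    obtain ⟨p, hp, hip, hlast⟩ := exists_last hP.finite (hb i)
    refine ⟨p, hp, fun z hz => hf.eq_of_last hip hlast (lt_of_le_of_lt ?_ hz.1)⟩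
    by_contra! hlt
    exact hK p hp ⟨hlt, (habove p hp).trans_lt hx.2⟩

/-! ### Finiteness of the set of laps -/

theorem exists_Ioo_of_finite {S : Set ℝ} (hS : S.Finite) {a b : ℝ}
    (h : ∀ s ∈ S, s ∉ Icc a b) : ∃ α < a, ∃ β > b, ∀ s ∈ S, s ∉ Ioo α β := by
  induction S, hS using Set.Finite.induction_on with
  | empty => exact ⟨a - 1, by linarith, b + 1, by linarith, by simp⟩
  | @insert s S _ _ ih =>
    obtain ⟨α, hα, β, hβ, hI⟩ := ih fun t ht => h t (Or.inr ht)
    by_cases hs : s < a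
    · refine ⟨max α s, max_lt hα hs, β, hβ, ?_⟩
      rintro t (rfl | ht) ⟨h1, h2⟩
      · exact h1.not_ge (le_max_right _ _)
      · exact hI t ht ⟨(le_max_left _ _).trans_lt h1, h2⟩
    · have hsb : b < s := by
        by_contra! hle
        exact h s (Or.inl rfl) ⟨not_lt.1 hs, hle⟩
      refine ⟨α, hα, min β s, lt_min hβ hsb, ?_⟩
      rintro t (rfl | ht) ⟨h1, h2⟩
      · exact h2.not_ge (min_le_right _ _)
      · exact hI t ht ⟨h1, h2.trans_le (min_le_left _ _)⟩

/-- The position of `x` relative to a set `F`: the points of `F` that precede `x` on its branch,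
recorded by branches. If `a ∈ F`, points outside `F` have the same position exactly when they
lie in the same component of the complement of `F`. -/
def position (F : Set Triod) (x : Triod) : Set (ZMod 3 × Triod) :=
  {q | q.2 ∈ F ∧ q.2.1 q.1 < x.1 q.1}

theorem position_subset (F : Set Triod) (x : Triod) : position F x ⊆ univ ×ˢ F :=
  fun _ hq => ⟨trivial, hq.1⟩

theorem onBranch_iff_of_position {F : Set Triod} (hF : center ∈ F) {i : ZMod 3} {x : Triod} :
    OnBranch i x ↔ (i, center) ∈ position F x := by
  simp only [position, mem_ofPred_eq, hF, true_and]
  rfl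

theorem exists_seg_of_position_eq {F : Set Triod} (hF : F.Finite) (hc : center ∈ F)
    {i : ZMod 3} {x y : Triod} (hx : x ∉ F) (hy : y ∉ F) (hi : OnBranch i x)
    (hxy : position F x = position F y) :
    ∃ α β, 0 ≤ α ∧ x ∈ seg i α β ∧ y ∈ seg i α β ∧ ∀ w ∈ F, w ∉ seg i α β := by
  have hiy : OnBranch i y := by
    rw [onBranch_iff_of_position hc, ← hxy, ← onBranch_iff_of_position hc]
    exact hi
  have hiff : ∀ w ∈ F, w.1 i < x.1 i ↔ w.1 i < y.1 i := fun w hw => by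
    have h := Set.ext_iff.1 hxy (i, w)
    simpa [position, hw] using h
  obtain ⟨α, hα, β, hβ, hI⟩ := exists_Ioo_of_finite (S := (fun w : Triod => w.1 i) '' F)
    (a := min (x.1 i) (y.1 i)) (b := max (x.1 i) (y.1 i)) (hF.image _) (by
      rintro _ ⟨w, hw, rfl⟩ hI
      have hwx : w.1 i ≠ x.1 i := fun e => hx (by rwa [hi.ext e.symm])
      have hwy : w.1 i ≠ y.1 i := fun e => hy (by rwa [hiy.ext e.symm])
      have := hiff w hw
      rcases hI.1.lt_or_eq with h | h
      · have h2 : w.1 i < max (x.1 i) (y.1 i) :=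
          lt_of_le_of_ne hI.2 fun e => by
            rcases max_choice (x.1 i) (y.1 i) with h' | h' <;> rw [h'] at e
            · exact hwx e
            · exact hwy e
        rcases min_lt_iff.1 h with h | h <;> rcases lt_max_iff.1 h2 with h2 | h2
        · exact h.not_gt h2
        · exact h.not_gt (this.2 h2)
        · exact h.not_gt (this.1 h2)
        · exact h.not_gt h2
      · rcases min_choice (x.1 i) (y.1 i) with h' | h' <;> rw [h'] at h
        · exact hwx h.symm
        · exact hwy h.symm)
  have hx0 : 0 < x.1 i := hi
  have hy0 : 0 < y.1 i := hiy
  obtain ⟨hαx, hαy⟩ := lt_min_iff.1 hα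
  obtain ⟨hβx, hβy⟩ := max_lt_iff.1 hβ
  refine ⟨max α 0, β, le_max_right _ _, ⟨max_lt hαx hx0, hβx⟩, ⟨max_lt hαy hy0, hβy⟩,
    fun w hw hws => hI _ ⟨w, hw, rfl⟩ ⟨(le_max_left _ _).trans_lt hws.1, hws.2⟩⟩

theorem IsLinearFor.finite_zeros {f : Triod → Triod} {P : Set Triod} (hP : IsCycle f P)
    (hb : ∀ i, ∃ p ∈ P, OnBranch i p) (hf : IsLinearFor f P) :
    {z | f z = center}.Finite := by
  have hF : (insert center P).Finite := hP.finite.insert _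
  have hc : center ∈ insert center P := mem_insert _ _
  have hZ : ∀ {z}, f z = center → z ≠ center → z ∉ insert center P := by
    rintro z hz hzc (h | h)
    · exact hzc h
    · exact hP.ne_center (hP.mapsTo h) hz
  refine Finite.of_injOn (f := position (insert center P)) (t := 𝒫 (univ ×ˢ insert center P))
    (fun z _ => position_subset _ z) ?_ (finite_univ.prod hF).finite_subsets
  intro z hz y hy hzy
  by_cases hzc : z = center
  · by_contra hne
    obtain ⟨i, hi⟩ := exists_onBranch (x := y) fun h => hne (hzc.trans h.symm)
    rw [onBranch_iff_of_position hc, ← hzy, ← onBranch_iff_of_position hc] at hi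
    exact hi.ne_center hzc
  · obtain ⟨i, hi⟩ := exists_onBranch hzc
    have hiy := hi
    rw [onBranch_iff_of_position hc, hzy, ← onBranch_iff_of_position hc] at hiy
    obtain ⟨α, β, hα, hzs, hys, hK⟩ :=
      exists_seg_of_position_eq hF hc (hZ hz hzc) (hZ hy hiy.ne_center) hi hzy
    rcases hf.injOn_or_const hP hb hα (fun p hp => hK p (mem_insert_of_mem _ hp)) with h | h
    · exact h hzs hys (hz.trans hy.symm)
    · obtain ⟨p, hp, h⟩ := h
      exact absurd ((h z hzs).symm.trans hz) (hP.ne_center (hP.mapsTo hp))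

/-- The sets whose maximal elements are the laps. -/
def IsMonotoneDomain (f : Triod → Triod) (V : Set Triod) : Prop :=
  IsOpen V ∧ IsConnected V ∧ IsMonotoneOn f V

theorem IsMonotoneDomain.exists_lap {f : Triod → Triod} {V : Set Triod}
    (hV : IsMonotoneDomain f V) : ∃ U ∈ laps f, V ⊆ U := by
  obtain ⟨U, hVU, hU⟩ := zorn_subset_nonempty {V | IsMonotoneDomain f V} (fun c hc hchain hne => by
    have hdir : DirectedOn (· ⊆ ·) c := hchain.directedOn
    obtain ⟨V₀, hV₀⟩ := hne
    refine ⟨⋃₀ c, ⟨isOpen_sUnion fun s hs => (hc hs).1, ⟨?_, ?_⟩, fun v hv => ⟨?_, ?_⟩⟩,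
      fun s hs => subset_sUnion_of_mem hs⟩
    · exact (hc hV₀).2.1.nonempty.mono (subset_sUnion_of_mem hV₀)
    · exact IsPreconnected.sUnion_directed hdir fun s hs => (hc hs).2.1.isPreconnected
    · obtain ⟨x, hx, rfl⟩ := hv
      exact ⟨x, hx, rfl⟩
    · have : ⋃₀ c ∩ f ⁻¹' {v} = ⋃₀ ((fun s => s ∩ f ⁻¹' {v}) '' c) := by
        rw [sUnion_image, sUnion_eq_biUnion, iUnion₂_inter]
      rw [this]
      refine IsPreconnected.sUnion_directed ?_ ?_
      · rintro _ ⟨s, hs, rfl⟩ _ ⟨t, ht, rfl⟩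
        obtain ⟨r, hr, hsr, htr⟩ := hdir s hs t ht
        exact ⟨_, ⟨r, hr, rfl⟩, inter_subset_inter_left _ hsr, inter_subset_inter_left _ htr⟩
      · rintro _ ⟨s, hs, rfl⟩
        rcases (s ∩ f ⁻¹' {v}).eq_empty_or_nonempty with h | ⟨x, hx, hxv⟩
        · simp only [h]; exact isPreconnected_empty
        · exact ((hc hs).2.2 v ⟨x, hx, hxv⟩).isPreconnected) V hV
  exact ⟨U, hU, hVU⟩

theorem IsMonotoneOn.eq_of_coord_between {f : Triod → Triod} {U : Set Triod}
    (hU : IsMonotoneOn f U) {i : ZMod 3} {z z' s : Triod} (hz : z ∈ U) (hz' : z' ∈ U)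
    (hf : f z = f z') (hs : OnBranch i s) (h1 : z.1 i ≤ s.1 i) (h2 : s.1 i ≤ z'.1 i) :
    f s = f z :=
  (mem_of_isPreconnected (hU (f z) ⟨z, hz, rfl⟩).isPreconnected ⟨hz, rfl⟩ ⟨hz', hf.symm⟩ hs
    h1 h2).2

/-- The part of a connected set on one side of one of its points is connected. -/
theorem isPreconnected_inter_ge {U : Set Triod} (hU : IsPreconnected U) {i : ZMod 3} {x : Triod}
    (hx : x ∈ U) (hi : OnBranch i x) : IsPreconnected (U ∩ {z | x.1 i ≤ z.1 i}) := by
  classical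
  have hcont : Continuous fun z : Triod => if x.1 i ≤ z.1 i then z else x :=
    Continuous.if_le continuous_id continuous_const continuous_const (continuous_coord i)
      fun z hz => (hi.ext hz).symm
  convert hU.image _ hcont.continuousOn using 1
  ext z
  constructor
  · rintro ⟨hz, hxz⟩
    exact ⟨z, hz, if_pos hxz⟩
  · rintro ⟨w, hw, rfl⟩
    dsimp only
    split_ifs with h
    · exact ⟨hw, h⟩
    · exact ⟨hx, le_refl (x.1 i)⟩

theorem isPreconnected_inter_le {U : Set Triod} (hU : IsPreconnected U) {i : ZMod 3} {x : Triod}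
    (hx : x ∈ U) (hi : OnBranch i x) : IsPreconnected (U ∩ {z | z.1 i ≤ x.1 i}) := by
  classical
  have hcont : Continuous fun z : Triod => if z.1 i ≤ x.1 i then z else x :=
    Continuous.if_le continuous_id continuous_const (continuous_coord i) continuous_const
      fun z hz => (hi.ext hz.symm).symm
  convert hU.image _ hcont.continuousOn using 1
  ext z
  constructor
  · rintro ⟨hz, hxz⟩
    exact ⟨z, hz, if_pos hxz⟩
  · rintro ⟨w, hw, rfl⟩
    dsimp only
    split_ifs with h
    · exact ⟨hw, h⟩
    · exact ⟨hx, le_refl (x.1 i)⟩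

/-- A monotone domain `U` that meets an interval `K` on which `f` is injective and misses `a` takes
no value at a point `s ∈ K \ U`: on its way from a point `x ∈ U ∩ K` to a point with the
value `f s`, the map would repeat a value taken between `s` and `x`. -/
theorem IsMonotoneDomain.apply_ne {f : Triod → Triod} (hf : Continuous f) {U : Set Triod}
    (hU : IsMonotoneDomain f U) {i : ZMod 3} {α β : ℝ} (hα : 0 ≤ α)
    (hinj : InjOn f (seg i α β)) (hZ : ∀ z ∈ seg i α β, f z ≠ center) {x s t : Triod}
    (hxU : x ∈ U) (hxK : x ∈ seg i α β) (hsU : s ∉ U) (hsK : s ∈ seg i α β) (htU : t ∈ U) :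
    f s ≠ f t := by
  intro hst
  have hix := onBranch_of_mem_seg hα hxK
  have his := onBranch_of_mem_seg hα hsK
  obtain ⟨j, hj⟩ := exists_onBranch (hZ s hsK)
  have hKj : ∀ y ∈ seg i α β, OnBranch j (f y) := by
    intro y hy
    by_contra hn
    obtain ⟨z, hz, hzc⟩ := center_mem_of_isPreconnected
      ((isPreconnected_seg i hα).image f hf.continuousOn) (mem_image_of_mem f hsK)
      (mem_image_of_mem f hy) hj hn
    exact hZ z hz hzc
  have htK : t ∉ seg i α β := fun h => hsU (by rwa [hinj hsK h hst])
  let φ : Triod → ℝ := fun z => (f z).1 j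
  have hφ : Continuous φ := (continuous_coord j).comp hf
  have hsub : ∀ r ∈ uIcc (s.1 i) (x.1 i), leg i r ∈ seg i α β ∧ (leg i r).1 i = r := by
    intro r hr
    have h1 : α < r := (lt_min hsK.1 hxK.1).trans_le hr.1
    have h2 : r < β := hr.2.trans_lt (max_lt hsK.2 hxK.2)
    have h3 := leg_same i (hα.trans h1.le) (hr.2.trans (max_le (s.2.1 i).2 (x.2.1 i).2))
    exact ⟨by unfold seg; rw [mem_ofPred_eq, h3]; exact ⟨h1, h2⟩, h3⟩
  have hinjφ : InjOn (fun r => φ (leg i r)) (uIcc (s.1 i) (x.1 i)) := by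
    intro r hr r' hr' h
    obtain ⟨h1, h2⟩ := hsub r hr
    obtain ⟨h1', h2'⟩ := hsub r' hr'
    have := hinj h1 h1' ((hKj _ h1).ext h)
    rw [← h2, ← h2', this]
  have hmaps : ∀ r ∈ uIcc (s.1 i) (x.1 i), φ (leg i r) ∈ uIcc (φ t) (φ x) := by
    intro r hr
    have hφt : φ t = φ (leg i (s.1 i)) := by
      rw [his.leg_coord]; simp only [φ, hst]
    have hφx : φ x = φ (leg i (x.1 i)) := by rw [hix.leg_coord]
    rw [hφt, hφx]
    rcases ContinuousOn.strictMonoOn_of_injOn_Icc' (min_le_max (a := s.1 i) (b := x.1 i))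
      (hφ.comp (continuous_leg i)).continuousOn hinjφ with h | h
    · exact MonotoneOn.mapsTo_uIcc (f := fun r => φ (leg i r)) h.monotoneOn hr
    · exact AntitoneOn.mapsTo_uIcc (f := fun r => φ (leg i r)) h.antitoneOn hr
  have hnear : ∀ᶠ r in 𝓝 (x.1 i), leg i r ∈ U :=
    (continuous_leg i).continuousAt.eventually
      (by rw [hix.leg_coord]; exact hU.1.mem_nhds hxU)
  -- `C` is the part of `U` beyond `x`, seen from `s`.
  have key : ∀ C ⊆ U, IsPreconnected C → x ∈ C → t ∈ C → ∀ r ∈ uIcc (s.1 i) (x.1 i),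
      r ≠ x.1 i → leg i r ∈ U → (∀ y ∈ C, r ≤ x.1 i ∧ x.1 i ≤ y.1 i ∨
        y.1 i ≤ x.1 i ∧ x.1 i ≤ r) → False := by
    intro C hCU hC hxC htC r hr hrx hrU hside
    obtain ⟨hrK, hrr⟩ := hsub r hr
    have hIVT : φ (leg i r) ∈ φ '' C :=
      ((hC.image φ hφ.continuousOn).ordConnected.uIcc_subset (mem_image_of_mem φ htC)
        (mem_image_of_mem φ hxC)) (hmaps r hr)
    obtain ⟨y, hyC, hy⟩ := hIVT
    have hfy : f y = f (leg i r) := ((hKj _ hrK).ext hy.symm).symm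
    have hfx : f x = f (leg i r) := by
      rcases hside y hyC with h | h
      · exact hU.2.2.eq_of_coord_between hrU (hCU hyC) hfy.symm hix (by rw [hrr]; exact h.1) h.2
      · exact (hU.2.2.eq_of_coord_between (hCU hyC) hrU hfy hix h.1
          (by rw [hrr]; exact h.2)).trans hfy
    exact hrx (by rw [← hrr, hinj hxK hrK hfx])
  rcases lt_trichotomy (s.1 i) (x.1 i) with hlt | heq | hgt
  · have hxt : x.1 i ≤ t.1 i := by
      by_contra! h
      rcases le_or_gt (t.1 i) (s.1 i) with h' | h'
      · exact hsU (mem_of_isPreconnected hU.2.1.isPreconnected htU hxU his h' hlt.le)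
      · exact htK ⟨hsK.1.trans h', h.trans hxK.2⟩
    obtain ⟨r, hrU, hr⟩ := ((hnear.filter_mono nhdsWithin_le_nhds).and
      (Ioo_mem_nhdsLT hlt)).exists
    exact key _ inter_subset_left (isPreconnected_inter_ge hU.2.1.isPreconnected hxU hix)
      ⟨hxU, le_refl (x.1 i)⟩ ⟨htU, hxt⟩ r (mem_uIcc_of_le hr.1.le hr.2.le) hr.2.ne hrU
      fun y hy => Or.inl ⟨hr.2.le, hy.2⟩
  · exact hsU (by rwa [his.ext heq])
  · have hxt : t.1 i ≤ x.1 i := by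
      by_contra! h
      rcases le_or_gt (s.1 i) (t.1 i) with h' | h'
      · exact hsU (mem_of_isPreconnected hU.2.1.isPreconnected hxU htU his hgt.le h')
      · exact htK ⟨hxK.1.trans h, h'.trans hsK.2⟩
    obtain ⟨r, hrU, hr⟩ := ((hnear.filter_mono nhdsWithin_le_nhds).and
      (Ioo_mem_nhdsGT hgt)).exists
    exact key _ inter_subset_left (isPreconnected_inter_le hU.2.1.isPreconnected hxU hix)
      ⟨hxU, le_refl (x.1 i)⟩ ⟨htU, hxt⟩ r (mem_uIcc_of_ge hr.1.le hr.2.le) hr.1.ne' hrU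
      fun y hy => Or.inr ⟨hy.2, hr.1.le⟩

/-- A lap that meets an interval free of points of `P` and of preimages of `a` contains it. -/
theorem IsLinearFor.seg_subset_lap {f : Triod → Triod} {P : Set Triod} (hP : IsCycle f P)
    (hb : ∀ i, ∃ p ∈ P, OnBranch i p) (hf : IsLinearFor f P) {U : Set Triod} (hU : U ∈ laps f)
    {i : ZMod 3} {α β : ℝ} (hα : 0 ≤ α) (hK : ∀ p ∈ P, p ∉ seg i α β)
    (hZ : ∀ z, f z = center → z ∉ seg i α β) {x : Triod} (hxU : x ∈ U)
    (hxK : x ∈ seg i α β) : seg i α β ⊆ U := by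
  have hmax : Maximal (IsMonotoneDomain f) U := hU
  have hUd := hmax.prop
  suffices h : IsMonotoneOn f (U ∪ seg i α β) from
    subset_union_right.trans (hmax.le_of_ge (show IsMonotoneDomain f (U ∪ seg i α β) from
      ⟨hUd.1.union (isOpen_seg i α β),
        hUd.2.1.union ⟨x, hxU, hxK⟩ ⟨⟨x, hxK⟩, isPreconnected_seg i hα⟩, h⟩)
      subset_union_left)
  rcases hf.injOn_or_const hP hb hα hK with hinj | ⟨p, -, hp⟩
  · rintro v ⟨y, hy, hyv⟩
    by_cases hs : ∃ s ∈ seg i α β, s ∉ U ∧ f s = v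
    · obtain ⟨s, hsK, hsU, rfl⟩ := hs
      convert isConnected_singleton (x := s)
      refine Subset.antisymm ?_ (singleton_subset_iff.2 ⟨Or.inr hsK, rfl⟩)
      rintro t ⟨htU | htK, hts⟩
      · exact absurd hts.symm (hUd.apply_ne hf.continuous hα hinj (fun z hz hzc => hZ z hzc hz)
          hxU hxK hsU hsK htU)
      · exact hinj htK hsK hts
    · have hin : ∀ s, s ∈ U ∪ seg i α β → f s = v → s ∈ U := fun s hsK hsv => by
        by_contra hsU
        exact hs ⟨s, hsK.resolve_left hsU, hsU, hsv⟩
      have : (U ∪ seg i α β) ∩ f ⁻¹' {v} = U ∩ f ⁻¹' {v} :=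
        Subset.antisymm (fun s hs => ⟨hin s hs.1 hs.2, hs.2⟩)
          (inter_subset_inter_left _ subset_union_left)
      rw [this]
      exact hUd.2.2 v ⟨y, hin y hy hyv, hyv⟩
  · rintro v ⟨y, hy, hyv⟩
    rw [union_inter_distrib_right]
    by_cases hv : v = f p
    · have : seg i α β ∩ f ⁻¹' {v} = seg i α β :=
        inter_eq_left.2 fun z hz => (hp z hz).trans hv.symm
      rw [this]
      have hxv : f x = v := (hp x hxK).trans hv.symm
      exact (hUd.2.2 v ⟨x, hxU, hxv⟩).union ⟨x, ⟨hxU, hxv⟩, hxK⟩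
        ⟨⟨x, hxK⟩, isPreconnected_seg i hα⟩
    · have : seg i α β ∩ f ⁻¹' {v} = ∅ :=
        eq_empty_of_forall_notMem fun z hz => hv (hz.2.symm.trans (hp z hz.1))
      rw [this, union_empty]
      exact hUd.2.2 v ⟨y, hy.resolve_right fun h => hv (hyv.symm.trans (hp y h)), hyv⟩

/-- Let `F` consist of the points of `P` and the preimages of `a`. A lap is determined by its
points in `F` and the components of the complement of `F` that it meets. -/
theorem IsLinearFor.finite_laps {f : Triod → Triod} {P : Set Triod} (hP : IsCycle f P)
    (hb : ∀ i, ∃ p ∈ P, OnBranch i p) (hf : IsLinearFor f P) : (laps f).Finite := by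
  let F : Set Triod := P ∪ {z | f z = center}
  have hF : F.Finite := hP.finite.union (hf.finite_zeros hP hb)
  have hc : center ∈ F := Or.inr hf.map_center
  refine Finite.of_injOn (f := fun U => (U ∩ F, position F '' (U \ F)))
    (t := (𝒫 F) ×ˢ (𝒫 (𝒫 (univ ×ˢ F)))) ?_ ?_
    (hF.finite_subsets.prod (finite_univ.prod hF).finite_subsets.finite_subsets)
  · rintro U -
    refine ⟨inter_subset_right, ?_⟩
    rintro _ ⟨x, -, rfl⟩
    exact position_subset F x
  · have hsub : ∀ U V, V ∈ laps f → U ∩ F = V ∩ F →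
        position F '' (U \ F) = position F '' (V \ F) → U ⊆ V := by
      intro U V hV h1 h2 x hx
      by_cases hxF : x ∈ F
      · exact (h1.subset ⟨hx, hxF⟩).1
      · obtain ⟨y, ⟨hyV, hyF⟩, hxy⟩ := h2.subset ⟨x, ⟨hx, hxF⟩, rfl⟩
        obtain ⟨i, hi⟩ := exists_onBranch (x := y) fun h => hyF (h ▸ hc)
        obtain ⟨α, β, hα, hys, hxs, hK⟩ := exists_seg_of_position_eq hF hc hyF hxF hi hxy
        exact hf.seg_subset_lap hP hb hV hα (fun p hp => hK p (Or.inl hp))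
          (fun z hz => hK z (Or.inr hz)) hyV hys hxs
    intro U hU V hV h
    obtain ⟨h1, h2⟩ := Prod.ext_iff.1 h
    exact Subset.antisymm (hsub U V hV h1 h2) (hsub V U hU h1.symm h2.symm)

/-! ### Color changes and laps -/

/-- The pairs of consecutive points of `P` on a branch with images on different branches, that
is, of different colors. -/
def colorChanges (f : Triod → Triod) (P : Set Triod) : Set (Triod × Triod) :=
  {e | ∃ i, IsGap P i e.1 e.2 ∧ e.1 ∈ P ∧ OnBranch i e.1 ∧
    ∃ j, OnBranch j (f e.1) ∧ ¬ OnBranch j (f e.2)}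

theorem IsGap.exists_zero {f : Triod → Triod} (hf : Continuous f) {P : Set Triod} {i : ZMod 3}
    {u w : Triod} (h : IsGap P i u w) (hcP : ∀ p ∈ P, f p ≠ center) (hu : u ∈ P)
    (hiu : OnBranch i u) {j : ZMod 3} (hj : OnBranch j (f u)) (hj' : ¬ OnBranch j (f w)) :
    ∃ z ∈ seg i (u.1 i) (w.1 i), f z = center := by
  obtain ⟨_, ⟨r, hr, rfl⟩, hz⟩ := center_mem_of_isPreconnected
    (C := f '' (leg i '' Icc (u.1 i) (w.1 i)))
    ((isPreconnected_Icc.image _ (continuous_leg i).continuousOn).image _ hf.continuousOn)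
    ⟨u, ⟨u.1 i, left_mem_Icc.2 h.lt.le, hiu.leg_coord⟩, rfl⟩
    ⟨w, ⟨w.1 i, right_mem_Icc.2 h.lt.le, h.onBranch.leg_coord⟩, rfl⟩ hj hj'
  refine ⟨leg i r, ?_, hz⟩
  unfold seg
  rw [mem_ofPred_eq, leg_same i ((u.2.1 i).1.trans hr.1) (hr.2.trans (w.2.1 i).2)]
  refine ⟨lt_of_le_of_ne hr.1 ?_, lt_of_le_of_ne hr.2 ?_⟩
  · rintro rfl
    exact hcP u hu (by rwa [hiu.leg_coord] at hz)
  · rintro rfl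
    exact hcP w h.right (by rwa [h.onBranch.leg_coord] at hz)

theorem isMonotoneDomain_seg {f : Triod → Triod} {i : ZMod 3} {α β : ℝ} (hα : 0 ≤ α)
    (hne : (seg i α β).Nonempty) (hinj : InjOn f (seg i α β)) :
    IsMonotoneDomain f (seg i α β) := by
  refine ⟨isOpen_seg i α β, ⟨hne, isPreconnected_seg i hα⟩, ?_⟩
  rintro _ ⟨x, hx, rfl⟩
  convert isConnected_singleton (x := x)
  exact Subset.antisymm (fun y hy => hinj hy.1 hx hy.2) (singleton_subset_iff.2 ⟨hx, rfl⟩)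

/-- Each color change produces a preimage of `a`, and preimages of `a` separated by a point of
`P` belong to different laps. -/
theorem IsLinearFor.ncard_colorChanges_le {f : Triod → Triod} {P : Set Triod}
    (hP : IsCycle f P) (hb : ∀ i, ∃ p ∈ P, OnBranch i p) (hf : IsLinearFor f P) :
    (colorChanges f P).ncard ≤ modality f := by
  have hcP : ∀ p ∈ P, f p ≠ center := fun p hp => hP.ne_center (hP.mapsTo hp)
  have hex : ∀ e ∈ colorChanges f P, ∃ U ∈ laps f, ∃ i, ∃ z ∈ U,
      z ∈ seg i (e.1.1 i) (e.2.1 i) ∧ f z = center ∧ IsGap P i e.1 e.2 ∧ e.1 ∈ P ∧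
        OnBranch i e.1 := by
    rintro e ⟨i, hgap, hu, hiu, j, hj, hj'⟩
    obtain ⟨z, hz, hzc⟩ := hgap.exists_zero hf.continuous hcP hu hiu hj hj'
    obtain ⟨U, hU, hsub⟩ := (isMonotoneDomain_seg hgap.left_nonneg ⟨z, hz⟩
      (hf.injOn_of_isGap hP hb hgap)).exists_lap
    exact ⟨U, hU, i, z, hsub hz, hz, hzc, hgap, hu, hiu⟩
  choose! L hL using hex
  refine ncard_le_ncard_of_injOn L (fun e he => (hL e he).1) ?_ (hf.finite_laps hP hb)
  rintro ⟨u, w⟩ he ⟨u', w'⟩ he' hLL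
  obtain ⟨hU, i, z, hzU, hz, hzc, hgap, hu, hiu⟩ := hL _ he
  obtain ⟨-, i', z', hzU', hz', hzc', hgap', hu', hiu'⟩ := hL _ he'
  rw [← hLL] at hzU'
  have hmono : IsMonotoneOn f (L (u, w)) := (show Maximal (IsMonotoneDomain f) _ from hU).prop.2.2
  dsimp only at *
  have hsep : ∀ k, ∀ p ∈ P, ∀ y ∈ L (u, w), ∀ y' ∈ L (u, w), f y = center → f y' = center →
      OnBranch k p → y.1 k ≤ p.1 k → p.1 k ≤ y'.1 k → False :=
    fun k p hp y hy y' hy' hyc hyc' hkp h1 h2 =>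
      hcP p hp ((hmono.eq_of_coord_between hy hy' (hyc.trans hyc'.symm) hkp h1 h2).trans hyc)
  by_cases hii : i' = i
  · subst hii
    rcases lt_trichotomy (w.1 i') (w'.1 i') with hlt | heq | hgt
    · have hle := (hgap'.empty w hgap.right).resolve_right hlt.not_ge
      exact (hsep i' w hgap.right z hzU z' hzU' hzc hzc' hgap.onBranch hz.2.le
        (hle.trans hz'.1.le)).elim
    · have hw : w = w' := hgap.onBranch.ext heq
      subst hw
      have h1 := (hgap'.empty u hu).resolve_right hgap.lt.not_ge
      have h2 := (hgap.empty u' hu').resolve_right hgap'.lt.not_ge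
      rw [hiu.ext (le_antisymm h1 h2)]
    · have hle := (hgap.empty w' hgap'.right).resolve_right hgt.not_ge
      exact (hsep i' w' hgap'.right z' hzU' z hzU hzc' hzc hgap'.onBranch hz'.2.le
        (hle.trans hz.1.le)).elim
  · have h0 : z'.1 i = 0 :=
      (onBranch_of_mem_seg hgap'.left_nonneg hz').eq_zero fun h => hii h.symm
    exact (hsep i u hu z' hzU' z hzU hzc' hzc hiu (by rw [h0]; exact hgap.left_nonneg)
      hz.1.le).elim

/-! ### Counting states -/

theorem HasColor.onBranch {b : Equiv.Perm (ZMod 3)} {f : Triod → Triod} {c i : ZMod 3}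
    {x : Triod} (h : HasColor b f c x) (hi : OnBranch (b i) x) :
    OnBranch (b (i + c)) (f x) := by
  obtain ⟨k, hk, hkc⟩ := h
  have : k = i := b.injective (hk.unique hi)
  rwa [← this]

theorem HasColor.unique {b : Equiv.Perm (ZMod 3)} {f : Triod → Triod} {c c' : ZMod 3}
    {x : Triod} (h : HasColor b f c x) (h' : HasColor b f c' x) : c = c' := by
  obtain ⟨i, hi, hic⟩ := h
  exact add_left_cancel (b.injective (hic.unique (h'.onBranch hi)))

theorem between_iff_of_onBranch {i : ZMod 3} {x y z : Triod} (hx : OnBranch i x)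
    (hy : OnBranch i y) : Between x z y ↔ z.1 i ∈ uIcc (x.1 i) (y.1 i) := by
  rw [between_iff]
  refine ⟨fun h => h i, fun h k => ?_⟩
  by_cases hk : k = i
  · rwa [hk]
  · have hx0 : 0 < x.1 i := hx
    have hz : OnBranch i z := (lt_min hx0 hy).trans_le h.1
    rw [hx.eq_zero hk, hy.eq_zero hk, hz.eq_zero hk]
    simp

theorem mem_stateOf_iff {b : Equiv.Perm (ZMod 3)} {f : Triod → Triod} {P : Set Triod}
    {c i : ZMod 3} {x y : Triod} (hx : OnBranch i x) :
    y ∈ stateOf b f P c x ↔ y ∈ P ∧ OnBranch i y ∧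
      ∀ z ∈ P, z.1 i ∈ uIcc (x.1 i) (y.1 i) → HasColor b f c z := by
  constructor
  · rintro ⟨hy, -, ⟨k, hkx, hky⟩, h⟩
    have : k = i := hkx.unique hx
    subst this
    exact ⟨hy, hky, fun z hz hzI => h z hz ((between_iff_of_onBranch hx hky).2 hzI)⟩
  · rintro ⟨hy, hiy, h⟩
    exact ⟨hy, h y hy right_mem_uIcc, ⟨i, hx, hiy⟩,
      fun z hz hzI => h z hz ((between_iff_of_onBranch hx hiy).1 hzI)⟩

theorem stateOf_eq_of_mem {b : Equiv.Perm (ZMod 3)} {f : Triod → Triod} {P : Set Triod}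
    {c i : ZMod 3} {x y : Triod} (hx : OnBranch i x) (hy : y ∈ stateOf b f P c x) :
    stateOf b f P c y = stateOf b f P c x := by
  obtain ⟨-, hiy, hxy⟩ := (mem_stateOf_iff hx).1 hy
  ext w
  rw [mem_stateOf_iff hx, mem_stateOf_iff hiy]
  refine and_congr_right fun _ => and_congr_right fun _ => ⟨fun h z hz hzI => ?_,
    fun h z hz hzI => ?_⟩
  · rcases uIcc_subset_uIcc_union_uIcc (b := y.1 i) hzI with h1 | h1
    · exact hxy z hz h1
    · exact h z hz h1
  · rcases uIcc_subset_uIcc_union_uIcc (b := x.1 i) hzI with h1 | h1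
    · exact hxy z hz (by rwa [uIcc_comm])
    · exact h z hz h1

/-- Consecutive points of `P` with different colors form a color change. -/
theorem mem_colorChanges {b : Equiv.Perm (ZMod 3)} {f : Triod → Triod} {P : Set Triod}
    (hP : IsCycle f P) {i : ZMod 3} {u w : Triod} (hu : u ∈ P) (hiu : OnBranch i u)
    (hgap : IsGap P i u w) {c : ZMod 3}
    (hc : ¬ (HasColor b f c u ↔ HasColor b f c w)) : (u, w) ∈ colorChanges f P := by
  obtain ⟨j, hj⟩ := hP.exists_onBranch (hP.mapsTo hu)
  refine ⟨i, hgap, hu, hiu, j, hj, fun hj' => hc ?_⟩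
  obtain ⟨n, rfl⟩ := b.surjective i
  constructor
  · intro h
    exact ⟨n, hgap.onBranch, by rwa [(h.onBranch hiu).unique hj]⟩
  · intro h
    exact ⟨n, hiu, by rwa [(h.onBranch hgap.onBranch).unique hj']⟩

/-- Below a point of color `c`, if not all points of the branch have this color, the state of
the point begins with a color change. -/
theorem exists_colorChange_below {b : Equiv.Perm (ZMod 3)} {f : Triod → Triod} {P : Set Triod}
    (hP : IsCycle f P) {c i : ZMod 3} {x y : Triod} (hx : x ∈ P) (hix : OnBranch i x)
    (hcx : HasColor b f c x) (hy : y ∈ P) (hiy : OnBranch i y) (hyx : y.1 i ≤ x.1 i)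
    (hcy : ¬ HasColor b f c y) :
    ∃ e ∈ colorChanges f P, HasColor b f c e.2 ∧ stateOf b f P c e.2 = stateOf b f P c x := by
  -- `u` is the last point below `x` of a different color, and `w` is the next one.
  obtain ⟨u, ⟨hu, hiu, hux, hcu⟩, humax⟩ := exists_max_image
    {p ∈ P | OnBranch i p ∧ p.1 i ≤ x.1 i ∧ ¬ HasColor b f c p} (fun q => q.1 i)
    (hP.finite.subset (sep_subset _ _)) ⟨y, hy, hiy, hyx, hcy⟩
  have hux' : u.1 i < x.1 i := lt_of_le_of_ne hux fun h => hcu (by rwa [hiu.ext h])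
  obtain ⟨w, ⟨hw, huw⟩, hwmin⟩ := exists_min_image {p ∈ P | u.1 i < p.1 i} (fun q => q.1 i)
    (hP.finite.subset (sep_subset _ _)) ⟨x, hx, hux'⟩
  have hu0 : 0 < u.1 i := hiu
  have hwx : w.1 i ≤ x.1 i := hwmin x ⟨hx, hux'⟩
  have hcol : ∀ z ∈ P, u.1 i < z.1 i → z.1 i ≤ x.1 i → HasColor b f c z := by
    intro z hz h1 h2
    by_contra hcz
    exact (humax z ⟨hz, hu0.trans h1, h2, hcz⟩).not_gt h1
  have hgap : IsGap P i u w := ⟨Or.inr ⟨hu, hiu⟩, hw, huw, fun z hz =>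
    (le_or_gt (z.1 i) (u.1 i)).imp_right fun h => hwmin z ⟨hz, h⟩⟩
  have hcw := hcol w hw huw hwx
  refine ⟨(u, w), mem_colorChanges hP hu hiu hgap fun h => hcu (h.2 hcw), hcw,
    stateOf_eq_of_mem hix ((mem_stateOf_iff hix).2 ⟨hw, hgap.onBranch, fun z hz hzI => ?_⟩)⟩
  rw [uIcc_of_ge hwx] at hzI
  exact hcol z hz (huw.trans_le hzI.1) hzI.2

theorem exists_colorChange_above {b : Equiv.Perm (ZMod 3)} {f : Triod → Triod} {P : Set Triod}
    (hP : IsCycle f P) {c i : ZMod 3} {x y : Triod} (hx : x ∈ P) (hix : OnBranch i x)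
    (hcx : HasColor b f c x) (hy : y ∈ P) (hxy : x.1 i ≤ y.1 i)
    (hcy : ¬ HasColor b f c y) :
    ∃ e ∈ colorChanges f P, ¬ HasColor b f c e.2 ∧
      stateOf b f P c e.1 = stateOf b f P c x := by
  have hx0 : 0 < x.1 i := hix
  obtain ⟨w, ⟨hw, hxw, hcw⟩, hwmin⟩ := exists_min_image
    {p ∈ P | x.1 i ≤ p.1 i ∧ ¬ HasColor b f c p} (fun q => q.1 i)
    (hP.finite.subset (sep_subset _ _)) ⟨y, hy, hxy, hcy⟩
  have hxw' : x.1 i < w.1 i := lt_of_le_of_ne hxw fun h => hcw (by rwa [← hix.ext h])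
  obtain ⟨u, ⟨hu, huw⟩, humax⟩ := exists_max_image {p ∈ P | p.1 i < w.1 i} (fun q => q.1 i)
    (hP.finite.subset (sep_subset _ _)) ⟨x, hx, hxw'⟩
  have hxu : x.1 i ≤ u.1 i := humax x ⟨hx, hxw'⟩
  have hiu : OnBranch i u := hx0.trans_le hxu
  have hcol : ∀ z ∈ P, x.1 i ≤ z.1 i → z.1 i < w.1 i → HasColor b f c z := by
    intro z hz h1 h2
    by_contra hcz
    exact (hwmin z ⟨hz, h1, hcz⟩).not_gt h2
  have hgap : IsGap P i u w := ⟨Or.inr ⟨hu, hiu⟩, hw, huw, fun z hz =>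
    (lt_or_ge (z.1 i) (w.1 i)).imp_left fun h => humax z ⟨hz, h⟩⟩
  have hcu := hcol u hu hxu huw
  refine ⟨(u, w), mem_colorChanges hP hu hiu hgap fun h => hcw (h.1 hcu), hcw,
    stateOf_eq_of_mem hix ((mem_stateOf_iff hix).2 ⟨hu, hiu, fun z hz hzI => ?_⟩)⟩
  rw [uIcc_of_le hxu] at hzI
  exact hcol z hz hzI.1 (hzI.2.trans_lt huw)

/-- Each state of a color other than black begins with a color change, and ends with one unless
it is the last state of its branch. -/
theorem two_mul_ncard_states_le {b : Equiv.Perm (ZMod 3)} {f : Triod → Triod} {P : Set Triod}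
    (hP : IsCycle f P) (hb : IsCanonical b f P) {c : ZMod 3} (hc : c ≠ black) :
    2 * (states b f P c).ncard ≤ (colorChanges f P).ncard + 3 := by
  have hbr : ∀ i, ∃ p ∈ P, OnBranch i p := fun i => by
    obtain ⟨n, rfl⟩ := b.surjective i
    obtain ⟨p, hp, hip, -⟩ := hb n
    exact ⟨p, hp, hip⟩
  have hfin : (colorChanges f P).Finite := by
    refine (hP.finite.prod hP.finite).subset ?_
    rintro e ⟨i, hgap, hu, -⟩
    exact ⟨hu, hgap.right⟩
  let A : Set (Triod × Triod) := {e ∈ colorChanges f P | HasColor b f c e.2}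
  let B : Set (Triod × Triod) := {e ∈ colorChanges f P | ¬ HasColor b f c e.2}
  have hA : A.Finite := hfin.subset (sep_subset _ _)
  have hB : B.Finite := hfin.subset (sep_subset _ _)
  have hAB : A.ncard + B.ncard = (colorChanges f P).ncard := by
    rw [← ncard_union_eq (disjoint_left.2 fun e h1 h2 => h2.2 h1.2) hA hB]
    congr 1
    ext e
    constructor
    · rintro (h | h) <;> exact h.1
    · intro h
      exact (em (HasColor b f c e.2)).imp (fun h' => ⟨h, h'⟩) fun h' => ⟨h, h'⟩
  have h1 : (states b f P c).ncard ≤ A.ncard := by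
    refine (ncard_le_ncard (t := (fun e => stateOf b f P c e.2) '' A) ?_
      (hA.image _)).trans (ncard_image_le hA)
    rintro S ⟨x, hx, hcx, rfl⟩
    obtain ⟨i, hix⟩ := hP.exists_onBranch hx
    obtain ⟨n, rfl⟩ := b.surjective i
    obtain ⟨p, hp, hip, hmin, hcp⟩ := hb n
    obtain ⟨e, he, hce, hst⟩ := exists_colorChange_below hP hx hix hcx hp hip (hmin x hx hix)
      fun h => hc (h.unique hcp)
    exact ⟨e, ⟨he, hce⟩, hst⟩
  have h2 : (states b f P c).ncard ≤ B.ncard + 3 := by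
    choose l hlP hil hlast using fun i => exists_last hP.finite (hbr i)
    have hl : (range fun i => stateOf b f P c (l i)).ncard ≤ 3 := by
      rw [← image_univ]
      refine (ncard_image_le finite_univ).trans ?_
      rw [ncard_univ, Nat.card_zmod]
    refine (ncard_le_ncard (t := (fun e => stateOf b f P c e.1) '' B ∪
      range fun i => stateOf b f P c (l i)) ?_
      ((hB.image _).union (finite_range _))).trans ((ncard_union_le _ _).trans
        (add_le_add (ncard_image_le hB) hl))
    rintro S ⟨x, hx, hcx, rfl⟩
    obtain ⟨i, hix⟩ := hP.exists_onBranch hx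
    by_cases h : ∃ y ∈ P, x.1 i ≤ y.1 i ∧ ¬ HasColor b f c y
    · obtain ⟨y, hy, hxy, hcy⟩ := h
      obtain ⟨e, he, hce, hst⟩ := exists_colorChange_above hP hx hix hcx hy hxy hcy
      exact Or.inl ⟨e, ⟨he, hce⟩, hst⟩
    · push Not at h
      refine Or.inr ⟨i, stateOf_eq_of_mem hix ((mem_stateOf_iff hix).2
        ⟨hlP i, hil i, fun z hz hzI => h z hz ?_⟩)⟩
      rw [uIcc_of_le (hlast i x hx)] at hzI
      exact hzI.1
  omega

end Triod

theorem lemma3p1 (b : Equiv.Perm (ZMod 3)) (f : Triod → Triod) (P : Set Triod)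
    (hP : Triod.IsTriodTwist b f P)
    (hb : ∀ b' : Equiv.Perm (ZMod 3), Triod.IsCanonical b' f P → Triod.IsCanonical b f P)
    (hf : Triod.IsLinearFor f P) :
    (Triod.laps f).Finite ∧
      ((Triod.states b f P Triod.green).ncard : ℝ) < (Triod.modality f : ℝ) / 2 + 2 ∧
      ((Triod.states b f P Triod.red).ncard : ℝ) < (Triod.modality f : ℝ) / 2 + 2 := by
  obtain ⟨hcyc, hreg, -⟩ := hP
  obtain ⟨b', hb'⟩ := hreg.exists_isCanonical hcyc
  have hcan := hb b' hb'
  have hbr : ∀ i, ∃ p ∈ P, Triod.OnBranch i p := fun i => by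
    obtain ⟨n, rfl⟩ := b.surjective i
    obtain ⟨p, hp, hip, -⟩ := hcan n
    exact ⟨p, hp, hip⟩
  have hle := hf.ncard_colorChanges_le hcyc hbr
  have key : ∀ c, c ≠ Triod.black →
      ((Triod.states b f P c).ncard : ℝ) < (Triod.modality f : ℝ) / 2 + 2 := by
    intro c hc
    have h1 := Triod.two_mul_ncard_states_le hcyc hcan hc
    have h2 : 2 * (Triod.states b f P c).ncard ≤ Triod.modality f + 3 := by omega
    have h3 : 2 * ((Triod.states b f P c).ncard : ℝ) ≤ (Triod.modality f : ℝ) + 3 := by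
      exact_mod_cast h2
    linarith
  exact ⟨hf.finite_laps hcyc hbr, key _ (by decide), key _ (by decide)⟩
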